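/- Let $R=\mathrm{GR}(4,m)$, $K=R/2R$ with $\mu:R\to K$ the reduction map, let $n$ be odd, $t\ge 0$, and let $\alpha\in R$ be a primitive $2n$-th root of unity with $\alpha^n=-1$. Let $C$ be the negacyclic code of length $n$ over $\mathbb Z_4$ (ideal of $\mathbb Z_4[z]/\langle z^n+1\rangle$) generated by a polynomial with roots $\alpha,\alpha^3,\dots,\alpha^{2t-1}$. Write $w$ for the Lee weight on $\mathbb Z_4^n$. For $\ell\in\mathbb Z$ let $<_\ell$ be the term order on $R[z]^2$ with $[z^i,0]<_\ell[z^j,0]$ and $[0,z^i]<_\ell[0,z^j]$ for $i<j$, and $[0,z^j]<_\ell[z^i,0]$ iff $j\le i+\ell$. Call an element of $R[z]^2$ regular if it is not in $2R[z]^2$. **Solution by Approximations** (input $U\in R[z]$, $r\ge0$). Start with $[f_1,g_1],\dots,[f_4,g_4]=[1,0],[2,0],[0,1],[0,2]$. For $k=0,\dots,r-1$ let $\zeta_i$ be the coefficient of $z^k$ in $f_iU-g_i$ and simultaneously replace every $[f_i,g_i]$ with $\zeta_i\neq0$ by $[f_i,g_i]-x[f_j,g_j]$, where $j$ is the first index such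 that the leading term of $[f_j,g_j]$ is $<_{-1}$ that of $[f_i,g_i]$ and $\zeta_i=x\zeta_j$ for some $x\in R$, or by $[zf_i,zg_i]$ if there is no such $j$. **Decoding algorithm** (input $v\in\mathbb Z_4^n$, identified with $v(z)=\sum_{j<n} v_jz^j$). 1. Compute $s_k=v(\alpha^k)$ for $k=1,3,\dots,2t-1$. 2. Compute the coefficients $u_1,u_3,\dots,u_{2t-1}$ of the odd series $u$ from $s_o(u^2-1)=zu'$, where $s_o=\sum_{k\text{ odd}}s_kz^k$. 3. Compute $T(z)=T_1z+\dots+T_tz^t$ modulo $z^{t+1}$ from $1+T(z^2)=(1+zu(z))^{-1}$. 4. Obtain a solution $[g,h]$ of the key equation $a(1+T)\equiv b \bmod z^{t+1}$ as the minimal regular element, with respect to $<_{-1}$, of the basis that Solution by Approximations returns for $U=1+T$, $r=t+1$. 5. Put $\sigma(z)=h(z^2)+z^{-1}(g(z^2)-h(z^2))$ and reduce it to $\mu\sigma\in K[z]$. 6. For $0\le j<n$ put $e^2_j=2$ if $\mu\alpha^{-j}$ is a double root of $\mu\sigma$, and $e^2_j=0$ otherwise. 7. Put $v'=v-e^2$.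 8. Repeat steps 1–4 with $v'$ in place of $v$ and compute $\sigma'(z)=h(z^2)+z^{-1}(g(z^2)-h(z^2))\in R[z]$. 9. For $0\le j<n$ put $e'_j=1$ if $\sigma'(\alpha^{-j})=0$, $e'_j=3$ if $\sigma'(\alpha^{-j+n})=0$, and $e'_j=0$ otherwise. 10. Output $v'-e'$. **Claim.** (a) *Correctness.* If $v=c+e$ with $c\in C$ and $w(e)\le t$, then the output is $c$; moreover $e^2$ is exactly the vector of double errors ($e^2_j=2$ if $e_j=2$, and $0$ otherwise), and $e'=e-e^2$ is the vector of errors $\pm1$. (b) Call $[a,b]\in R[z]^2$ admissible for $T\in R[z]$ if $a(1+T)\equiv b\bmod z^{t+1}$, $\deg a\le\frac{t+1}2$, $\deg b\le\frac t2$, $2\in(a,b)$, and the leading coefficient of $a$ (if $\deg a>\deg b$), respectively of $b$ (if $\deg a\le\deg b$), is a unit. Then (a) remains true when step 4 is performed by any procedure that returns an admissible pair for every $T$ for which one exists; and step 4 as described above is such a procedure (for every $T\in R[z]$). (c) For all $U\in R[z]$ and $r\ge0$, Solution by Approximations returns a Gröbner basis, with respect to $<_{-1}$, of $\{[a,b]\in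 R[z]^2: aU\equiv b\bmod z^r\}$ whose leading monomials are $[z^i,0],[2z^j,0],[0,z^k],[0,2z^l]$ with $i\ge j$, $k\ge l$. (d) *Complexity.* Count additions, subtractions, multiplications, divisions, tests for zero or divisibility, and reductions modulo 2, of elements of $R$, $K$ and $\mathbb Z_4$. There is an absolute constant $\kappa$ such that Solution by Approximations uses at most $\kappa(r+1)^2$ operations, steps 2–4 (the solution of the key equation from the syndromes) use at most $\kappa(t+1)^2$ operations, and the whole decoder uses at most $\kappa\big((t+1)^2+n(t+1)\big)$ operations. -/

import Mathlib

open Polynomial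

noncomputable section

/-! ### Galois rings of characteristic four, negacyclic codes, the Lee metric -/

/-- `R` is the Galois ring `GR(4, m)`: it is isomorphic to `ℤ₄[x] / (h)` for a monic polynomial `h`
of degree `m` whose reduction modulo `2` is irreducible. -/
def IsGaloisRing (m : ℕ) (R : Type) [CommRing R] [Algebra (ZMod 4) R] : Prop :=
  ∃ h : (ZMod 4)[X], h.Monic ∧ h.natDegree = m ∧
    Irreducible (h.map (ZMod.castHom (by norm_num : 2 ∣ 4) (ZMod 2))) ∧
    Nonempty (R ≃ₐ[ZMod 4] AdjoinRoot h)

/-- The residue field `K = R / 2R`. -/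
abbrev Residue (R : Type) [CommRing R] : Type := R ⧸ Ideal.span {(2 : R)}

/-- The ring `ℤ₄[x] / (xⁿ + 1)`, whose ideals are the negacyclic codes of length `n` over `ℤ₄`. -/
abbrev NegacyclicRing (n : ℕ) : Type := (ZMod 4)[X] ⧸ Ideal.span {(X ^ n + 1 : (ZMod 4)[X])}

/-- The class `c₀ + c₁ x + ⋯ + cₙ₋₁ xⁿ⁻¹` of a word `c ∈ ℤ₄ⁿ`. -/
def wordClass {n : ℕ} (c : Fin n → ZMod 4) : NegacyclicRing n :=
  Ideal.Quotient.mk _ (∑ j : Fin n, monomial (j : ℕ) (c j))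

/-- The Lee weight of an element of `ℤ₄`: the elements `0, 1, 2, 3` have weights `0, 1, 2, 1`. -/
def leeWeight (a : ZMod 4) : ℕ := min a.val (4 - a.val)

/-- The Lee distance on `ℤ₄ⁿ`. -/
def leeDist {n : ℕ} (v c : Fin n → ZMod 4) : ℕ := ∑ j, leeWeight (v j - c j)

/-! ### Computations with a count of arithmetic operations

The cost of a computation is the number of elementary operations (addition, subtraction,
multiplication, division, test for zero, test for divisibility, reduction modulo `2`) that it
performs on single elements of `R`, `R / 2R` and `ℤ₄`.  Moving data, reading a coefficient,
shifting a coefficient list and comparing exponents are not counted. -/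

/-- A result together with the number of elementary operations spent on it. -/
@[ext] structure Counted (A : Type) where
  val : A
  cost : ℕ

namespace Counted

instance : Monad Counted where
  pure a := ⟨a, 0⟩
  bind x f := ⟨(f x.val).val, x.cost + (f x.val).cost⟩

variable {A S : Type}

/-- Run `f i` for every `i : Fin k` and collect the results. -/
def tabulate {k : ℕ} (f : Fin k → Counted A) : Counted (Fin k → A) :=
  ⟨fun i => (f i).val, ∑ i, (f i).cost⟩

/-- `for i = 0, …, N - 1 do s := step i s`. -/
def loop (step : ℕ → S → Counted S) (s : S) : ℕ → Counted S
  | 0 => pure s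
  | N + 1 => do
    let s' ← loop step s N
    step N s'

variable [CommRing A]

/-- Elementary operation: addition. -/
def add (a b : A) : Counted A := ⟨a + b, 1⟩

/-- Elementary operation: subtraction. -/
def sub (a b : A) : Counted A := ⟨a - b, 1⟩

/-- Elementary operation: multiplication. -/
def mul (a b : A) : Counted A := ⟨a * b, 1⟩

open Classical in
/-- Elementary operation: is `a` zero? -/
def isZero (a : A) : Counted Bool := ⟨decide (a = 0), 1⟩

open Classical in
/-- Elementary operation: is `a` a multiple of `b`? -/
def isMultiple (a b : A) : Counted Bool := ⟨decide (b ∣ a), 1⟩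

open Classical in
/-- Elementary operation: division, i.e. some `x` with `a = b * x` if `a` is a multiple of `b`. -/
def div (a b : A) : Counted A := ⟨if h : b ∣ a then h.choose else 0, 1⟩

/-- Elementary operation: reduction modulo `2`. -/
def reduce (a : A) : Counted (Residue A) := ⟨Ideal.Quotient.mk _ a, 1⟩

/-- The sum `f 0 + ⋯ + f (N - 1)`. -/
def sum (N : ℕ) (f : ℕ → Counted A) : Counted A :=
  loop (fun i s => do
    let y ← f i
    add s y) 0 N

/-- The polynomial with coefficients `f 0, …, f (N - 1)`. -/
def ofCoeffs (N : ℕ) (f : ℕ → Counted A) : Counted A[X] :=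
  ⟨∑ i ∈ Finset.range N, monomial i (f i).val, ∑ i ∈ Finset.range N, (f i).cost⟩

/-- Horner's rule: the value at `x` of the polynomial with coefficients `f 0, …, f (N - 1)`. -/
def horner (N : ℕ) (f : ℕ → A) (x : A) : Counted A :=
  loop (fun i s => do
    let y ← mul s x
    add y (f (N - 1 - i))) 0 N

/-- The list `a, a b, a b², …, a bᴺ⁻¹`. -/
def geometric (a b : A) (N : ℕ) : Counted (ℕ → A) := do
  let r ← loop (fun i (r : (ℕ → A) × A) => do
    let y ← mul r.2 b
    pure (Function.update r.1 i r.2, y)) (fun _ => 0, a) N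
  pure r.1

end Counted

open Counted

variable {R : Type} [CommRing R]

/-! ### Gröbner bases in `R[z]²` -/

/-- A term of `R[z]²`: `inl i` stands for `[zⁱ, 0]` and `inr j` for `[0, zʲ]`. -/
abbrev PairTerm : Type := ℕ ⊕ ℕ

/-- The strict term order `<_ℓ`. -/
def termLT (ℓ : ℤ) : PairTerm → PairTerm → Prop
  | .inl i, .inl j => i < j
  | .inr i, .inr j => i < j
  | .inr j, .inl i => (j : ℤ) ≤ i + ℓ
  | .inl i, .inr j => ¬ (j : ℤ) ≤ i + ℓ

/-- The leading term, with respect to `<_ℓ`, of a pair whose components have the given degrees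
(a dummy value if both components are zero). -/
def leadTermOfDegrees (ℓ : ℤ) : WithBot ℕ → WithBot ℕ → PairTerm
  | none, none => .inr 0
  | none, some j => .inr j
  | some i, none => .inl i
  | some i, some j => if (j : ℤ) ≤ i + ℓ then .inl i else .inr j

/-- The leading term of a nonzero pair. -/
def leadTerm (ℓ : ℤ) (p : R[X] × R[X]) : PairTerm := leadTermOfDegrees ℓ p.1.degree p.2.degree

/-- The leading coefficient of a nonzero pair. -/
def leadCoeff (ℓ : ℤ) (p : R[X] × R[X]) : R :=
  match leadTerm ℓ p with
  | .inl i => p.1.coeff i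
  | .inr j => p.2.coeff j

/-- Divisibility of terms. -/
def termDvd : PairTerm → PairTerm → Prop
  | .inl i, .inl j => i ≤ j
  | .inr i, .inr j => i ≤ j
  | .inl _, .inr _ => False
  | .inr _, .inl _ => False

/-- The leading monomial of `p` divides the leading monomial of `q`. -/
def LeadMonomialDvd (ℓ : ℤ) (p q : R[X] × R[X]) : Prop :=
  termDvd (leadTerm ℓ p) (leadTerm ℓ q) ∧ leadCoeff ℓ p ∣ leadCoeff ℓ q

/-- `B` is a Gröbner basis of the submodule `M` of `R[z]²` with respect to `<_ℓ`. -/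
def IsGroebnerBasis (ℓ : ℤ) (M : Submodule R[X] (R[X] × R[X])) (B : Set (R[X] × R[X])) : Prop :=
  (∀ p ∈ B, p ∈ M ∧ p ≠ 0) ∧ ∀ q ∈ M, q ≠ 0 → ∃ p ∈ B, LeadMonomialDvd ℓ p q

/-- A Gröbner basis of four elements with leading monomials `[zⁱ, 0]`, `[2 zʲ, 0]`, `[0, zᵏ]`,
`[0, 2 zˡ]`, where `j ≤ i` and `l ≤ k`. -/
def IsStandardGroebnerBasis (ℓ : ℤ) (M : Submodule R[X] (R[X] × R[X]))
    (B : Fin 4 → R[X] × R[X]) : Prop :=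
  IsGroebnerBasis ℓ M (Set.range B) ∧
    ∃ i j k l : ℕ, j ≤ i ∧ l ≤ k ∧
      (leadTerm ℓ (B 0) = .inl i ∧ leadCoeff ℓ (B 0) = 1) ∧
      (leadTerm ℓ (B 1) = .inl j ∧ leadCoeff ℓ (B 1) = 2) ∧
      (leadTerm ℓ (B 2) = .inr k ∧ leadCoeff ℓ (B 2) = 1) ∧
      (leadTerm ℓ (B 3) = .inr l ∧ leadCoeff ℓ (B 3) = 2)

/-- The solution module `{[a, b] ∣ a U ≡ b mod zʳ}`. -/
def solutionModule (U : R[X]) (r : ℕ) : Submodule R[X] (R[X] × R[X]) where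
  carrier := {p | X ^ r ∣ p.1 * U - p.2}
  add_mem' {p q} hp hq := by
    have h : (p + q).1 * U - (p + q).2 = (p.1 * U - p.2) + (q.1 * U - q.2) := by
      simp only [Prod.fst_add, Prod.snd_add]; ring
    simpa only [Set.mem_ofPred_eq, h] using dvd_add hp hq
  zero_mem' := by simp
  smul_mem' c p hp := by
    have h : (c • p).1 * U - (c • p).2 = c * (p.1 * U - p.2) := by
      simp only [Prod.smul_fst, Prod.smul_snd, smul_eq_mul]; ring
    simpa only [Set.mem_ofPred_eq, h] using Dvd.dvd.mul_left hp c

/-! ### The method of Solution by Approximations -/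

/-- The degree of a polynomial with at most `N` coefficients, by inspection of its coefficients. -/
def findDegree (N : ℕ) (f : R[X]) : Counted (WithBot ℕ) :=
  loop (fun i d => do
    let b ← isZero (f.coeff i)
    pure (if b then d else (i : WithBot ℕ))) ⊥ N

/-- The leading term of a pair, by inspection of its coefficients. -/
def findLeadTerm (ℓ : ℤ) (N : ℕ) (p : R[X] × R[X]) : Counted PairTerm := do
  let d ← findDegree N p.1
  let d' ← findDegree N p.2
  pure (leadTermOfDegrees ℓ d d')

/-- The discrepancy `[f U - g]ₖ`. -/
def discrepancy (U : R[X]) (k : ℕ) (p : R[X] × R[X]) : Counted R := do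
  let y ← Counted.sum (k + 1) fun i => mul (p.1.coeff i) (U.coeff (k - i))
  sub y (p.2.coeff k)

/-- `f - x g` for polynomials with at most `N` coefficients. -/
def subMul (N : ℕ) (f : R[X]) (x : R) (g : R[X]) : Counted R[X] :=
  ofCoeffs N fun i => do
    let y ← mul x (g.coeff i)
    sub (f.coeff i) y

open Classical in
/-- The first `j` such that the leading term `τ j` lies below `τ i` and `ζ i` is a multiple
of `ζ j`, if there is one. -/
def findPivot (ℓ : ℤ) (τ : Fin 4 → PairTerm) (ζ : Fin 4 → R) (i : Fin 4) :
    Counted (Option (Fin 4)) := do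
  let d ← tabulate fun j => isMultiple (ζ i) (ζ j)
  pure ((List.finRange 4).find? fun j => decide (termLT ℓ (τ j) (τ i)) && d j)

/-- One round: from a basis for the modulus `zᵏ` to a basis for the modulus `zᵏ⁺¹`
(all polynomials are stored with `N` coefficients). -/
def approxStep (ℓ : ℤ) (U : R[X]) (N k : ℕ) (B : Fin 4 → R[X] × R[X]) :
    Counted (Fin 4 → R[X] × R[X]) := do
  let ζ ← tabulate fun i => discrepancy U k (B i)
  let τ ← tabulate fun i => findLeadTerm ℓ N (B i)
  tabulate fun i => do
    let b ← isZero (ζ i)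
    if b then
      pure (B i)
    else do
      let pivot ← findPivot ℓ τ ζ i
      match pivot with
      | some j => do
        let x ← div (ζ i) (ζ j)
        let f ← subMul N (B i).1 x (B j).1
        let g ← subMul N (B i).2 x (B j).2
        pure (f, g)
      | none => pure (X * (B i).1, X * (B i).2)

/-- Solution by Approximations: a basis of the solution module of `a U ≡ b mod zʳ`.
All intermediate polynomials have degree at most `r`. -/
def approxBasis (ℓ : ℤ) (U : R[X]) (r : ℕ) : Counted (Fin 4 → R[X] × R[X]) :=
  loop (approxStep ℓ U (r + 1)) ![(1, 0), (2, 0), (0, 1), (0, 2)] r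

/-- Is the polynomial with at most `N` coefficients outside `2R[z]`? -/
def isRegularPoly (N : ℕ) (f : R[X]) : Counted Bool :=
  loop (fun i s => do
    let b ← isMultiple (f.coeff i) 2
    pure (s || !b)) false N

open Classical in
/-- The minimal element, with respect to `<_ℓ`, among the regular basis elements
(those outside `2R[z]²`). -/
def minimalRegular (ℓ : ℤ) (N : ℕ) (B : Fin 4 → R[X] × R[X]) : Counted (R[X] × R[X]) := do
  let ρ ← tabulate fun i => do
    let b ← isRegularPoly N (B i).1
    let b' ← isRegularPoly N (B i).2
    pure (b || b')
  let τ ← tabulate fun i => findLeadTerm ℓ N (B i)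
  match (List.finRange 4).find? fun i =>
      ρ i && decide (∀ j, ρ j = true → ¬ termLT ℓ (τ j) (τ i)) with
  | some i => pure (B i)
  | none => pure 0

/-- The solution of the key equation `a (1 + T) ≡ b mod zᵗ⁺¹` found by Solution by
Approximations: the minimal regular element, with respect to `<_{-1}`, of a Gröbner basis. -/
def approxSolve (t : ℕ) (T : R[X]) : Counted (R[X] × R[X]) := do
  let u₀ ← add 1 (T.coeff 0)
  let U := T - C (T.coeff 0) + C u₀
  let B ← approxBasis (-1) U (t + 1)
  minimalRegular (-1) (t + 2) B

/-! ### The decoder -/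

/-- The pairs `[a, b]` that the decoder may use as a solution of the key equation. -/
structure IsKeySolution (t : ℕ) (T : R[X]) (p : R[X] × R[X]) : Prop where
  mem : p ∈ solutionModule (1 + T) (t + 1)
  degree_fst : 2 * p.1.natDegree ≤ t + 1
  degree_snd : 2 * p.2.natDegree ≤ t
  two_mem : (2 : R[X]) ∈ Ideal.span {p.1, p.2}
  unit_fst : p.2.degree < p.1.degree → IsUnit p.1.leadingCoeff
  unit_snd : p.1.degree ≤ p.2.degree → IsUnit p.2.leadingCoeff

/-- A procedure that returns such a pair whenever there is one. -/
def IsKeySolver (t : ℕ) (solve : R[X] → Counted (R[X] × R[X])) : Prop :=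
  ∀ T : R[X], (∃ p, IsKeySolution t T p) → IsKeySolution t T (solve T).val

variable [Algebra (ZMod 4) R]

/-- Step 1: the syndromes; entry `i` is `s_{2i+1} = v(α^{2i+1})`, for `i < t`. -/
def syndromes {n : ℕ} (t : ℕ) (α : R) (v : Fin n → ZMod 4) : Counted (ℕ → R) := do
  let α2 ← mul α α
  let x ← geometric α α2 t
  let s ← tabulate fun i : Fin t =>
    horner n (fun j => if h : j < n then algebraMap (ZMod 4) R (v ⟨j, h⟩) else 0) (x i)
  pure fun i => if h : i < t then s ⟨i, h⟩ else 0

/-- Step 2: the coefficients of `u`, from `s_o (u² - 1) = z u'`.  Entry `i` of the result is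
`u_{2i+1}`; the second list of the loop holds the coefficients of `u²`, entry `i` being the one
at `z^{2i+2}`.  The recursion reads
`(2i+1) u_{2i+1} = -s_{2i+1} + ∑_{l < i} s_{2l+1} (u²)_{2(i-l)}`. -/
def uCoeffs (t : ℕ) (s : ℕ → R) : Counted (ℕ → R) := do
  let r ← loop (fun i (r : (ℕ → R) × (ℕ → R)) => do
    let y ← Counted.sum i fun l => mul (s l) (r.2 (i - l - 1))
    let y' ← sub y (s i)
    let x ← div y' ((2 * i + 1 : ℕ) : R)
    let u := Function.update r.1 i x
    let q ← Counted.sum (i + 1) fun a => mul (u a) (u (i - a))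
    pure (u, Function.update r.2 i q)) (fun _ => 0, fun _ => 0) t
  pure r.1

/-- Step 3: the polynomial `T = T₁ z + ⋯ + Tₜ zᵗ`, from `(1 + T(z²)) (1 + z u(z)) = 1`, i.e.
`T_{i+1} = -u_{2i+1} - ∑_{j < i} u_{2j+1} T_{i-j}`. -/
def tPoly (t : ℕ) (u : ℕ → R) : Counted R[X] := do
  let T ← loop (fun i (T : ℕ → R) => do
    let y ← Counted.sum i fun j => mul (u j) (T (i - j))
    let y' ← add (u i) y
    let x ← sub 0 y'
    pure (Function.update T (i + 1) x)) (fun _ => 0) t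
  pure (∑ i ∈ Finset.range (t + 1), monomial i (T i))

/-- Steps 2, 3 and 4: from the syndromes to a solution of the key equation. -/
def solveFromSyndromes (solve : R[X] → Counted (R[X] × R[X])) (t : ℕ) (s : ℕ → R) :
    Counted (R[X] × R[X]) := do
  let u ← uCoeffs t s
  let T ← tPoly t u
  solve T

/-- The polynomial `h(z²) + z⁻¹ (g(z²) - h(z²))`, for `g, h` with at most `N` coefficients. -/
def locator (N : ℕ) (p : R[X] × R[X]) : Counted R[X] :=
  ofCoeffs (2 * N) fun k =>
    if Even k then pure (p.2.coeff (k / 2))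
    else sub (p.1.coeff (k / 2 + 1)) (p.2.coeff (k / 2 + 1))

/-- Is `x` a root of the polynomial with at most `N` coefficients? -/
def isRoot {A : Type} [CommRing A] (N : ℕ) (f : A[X]) (x : A) : Counted Bool := do
  let y ← horner N f.coeff x
  isZero y

/-- Is `x` a multiple root, i.e. a common root of `f` and its derivative? -/
def isDoubleRoot {A : Type} [CommRing A] (N : ℕ) (f : A[X]) (x : A) : Counted Bool := do
  let f' ← ofCoeffs (N - 1) fun i => mul ((i + 1 : ℕ) : A) (f.coeff (i + 1))
  let b ← isRoot N f x
  let b' ← isRoot (N - 1) f' x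
  pure (b && b')

/-- The output of the decoder: the double errors, the errors `±1`, and the codeword. -/
@[ext] structure DecoderOutput (n : ℕ) where
  doubleErrors : Fin n → ZMod 4
  unitErrors : Fin n → ZMod 4
  codeword : Fin n → ZMod 4

/-- The decoder, with a given procedure for the solution of the key equation. -/
def decodeWith (solve : R[X] → Counted (R[X] × R[X])) {n : ℕ} (t : ℕ) (α : R)
    (v : Fin n → ZMod 4) : Counted (DecoderOutput n) := do
  let αinv ← div 1 α
  let pos ← geometric 1 α (n + 1)
  let neg ← geometric 1 αinv n
  -- first pass: double errors, from the error locator polynomial modulo 2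
  let s ← syndromes t α v
  let p ← solveFromSyndromes solve t s
  let σ ← locator (t + 2) p
  let σbar ← ofCoeffs (2 * (t + 2)) fun k => reduce (σ.coeff k)
  let e2 ← tabulate fun j : Fin n => do
    let x ← reduce (neg j)
    let b ← isDoubleRoot (2 * (t + 2)) σbar x
    pure (if b then (2 : ZMod 4) else 0)
  let v' ← tabulate fun j => sub (v j) (e2 j)
  -- second pass: errors ±1, from the error locator polynomial over R
  let s' ← syndromes t α v'
  let p' ← solveFromSyndromes solve t s'
  let σ' ← locator (t + 2) p'
  let e1 ← tabulate fun j : Fin n => do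
    let b ← isRoot (2 * (t + 2)) σ' (neg j)
    let b' ← isRoot (2 * (t + 2)) σ' (pos (n - j))
    pure (if b then (1 : ZMod 4) else if b' then 3 else 0)
  let c ← tabulate fun j => sub (v' j) (e1 j)
  pure ⟨e2, e1, c⟩

/-- The decoder that solves the key equation by Solution by Approximations. -/
def decode {n : ℕ} (t : ℕ) (α : R) (v : Fin n → ZMod 4) : Counted (DecoderOutput n) :=
  decodeWith (approxSolve t) t α v

end

/-!
The proof rests on three observations about the chain ring `R = GR(4, m)`, whose ideals are
`0`, `2R` and `R`, and whose residue field is a domain `K = R / 2R` (`IsGR4`).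

*Solution by Approximations.*  Sending a pair `[a, b]` to the polynomial `a(x²) + x b(x²)`
(`interleave`) turns the order `<_{-1}` into the order by degree, so that leading terms and leading
coefficients of pairs are those of polynomials.  By induction on `k` the four pairs span the
leading monomials of the solutions modulo `zᵏ` (`ApproxInvariant`).  If a solution modulo `zᵏ⁺¹` had
the leading monomial of a basis element that was just multiplied by `z`, then its difference with a
unit multiple of that element would be a smaller solution modulo `zᵏ` with a discrepancy associated
to that of the element; as `R` is a chain ring, this forces a pivot
(`ApproxInvariant.exists_pivot`), contradicting the choice of the multiplication by `z`.

*Admissible solutions.*  For two solutions `[a, b]`, `[a', b']` of the key equation of small degree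
one has `a b' = b a'`.  If `2 = a A + b B`, then `2 [a', b'] = (a' A + b' B) [a, b]`, and
comparing modulo `2` shows that `[a', b']` is modulo `2` a multiple of `[a, b]`
(`IsKeySolution.exists_ratio`).  So if there is an admissible solution, then the admissible
solutions are exactly the solutions of least degree outside `2R[z]²`, and any two of them agree
modulo `2` up to a nonzero constant.

*The error locator polynomial.*  For `σ = ∏ (1 - x z)`, with a factor for each error `±1` and two
factors for each double error, write `σ = E(z²) + z F(z²)`.  Newton's identities for the odd power
sums of the `x` can be written without dividing by `2` (`newton_odd`); they say that `u = F / E`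
satisfies the differential equation of the decoder (`oddSeries_differential`), so that
`[E + z F, E]` solves the key equation that is computed from the syndromes.  It is admissible
because the locations are distinct modulo `2`: a prime ideal that contains `E(z²)` and
`F(z²)` contains some `1 - x z`, and only for a double error can this happen
(`two_mem_span_keyPair`).  Hence the
decoder finds `σ` modulo `2` up to a constant, and the double roots give the double errors.
Once these are removed, `E` and `z F` generate the unit ideal, and the decoder finds `σ` up to a
unit of `R[z]` (`pairLocator_eq_of_unimodular`), whose roots in `R` give the remaining errors.

The operation counts follow the loop structure of the algorithms.
-/

noncomputable section

open Counted

section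

/-! ### Galois rings of characteristic four as chain rings -/

/-- The facts about `GR(4, m)` that matter here: `R` is a local ring with maximal ideal `2R`, and
`2R` is the annihilator of `2`. -/
class IsGR4 (R : Type) [CommRing R] : Prop extends Nontrivial R where
  four_eq_zero : (4 : R) = 0
  two_dvd_of_two_mul_eq_zero : ∀ x : R, 2 * x = 0 → 2 ∣ x
  isUnit_of_not_two_dvd : ∀ x : R, ¬ 2 ∣ x → IsUnit x

/-- The reduction `μ : R → R / 2R`. -/
abbrev red (R : Type) [CommRing R] : R →+* Residue R := Ideal.Quotient.mk _

namespace IsGR4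

/-- Over any ring with `4 = 0`, elements congruent to `1` modulo `2` are their own inverses. -/
theorem isUnit_one_add_two_mul {A : Type} [CommRing A] (h4 : (4 : A) = 0) (w : A) :
    IsUnit (1 + 2 * w) :=
  IsUnit.of_mul_eq_one (1 + 2 * w) (by linear_combination (w + w ^ 2) * h4)

/-- Each property is checked on `ℤ₄[x]`: reduce modulo `2`, use there that the reduction of the
defining polynomial `h` is irreducible, and lift the result back. -/
theorem of_isGaloisRing {m : ℕ} {R : Type} [CommRing R] [Algebra (ZMod 4) R]
    (hR : IsGaloisRing m R) : IsGR4 R := by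
  obtain ⟨h, hmonic, -, hirr, ⟨e⟩⟩ := hR
  set φ : ZMod 4 →+* ZMod 2 := ZMod.castHom (by norm_num : 2 ∣ 4) (ZMod 2) with hφ
  have hφsurj : Function.Surjective φ := ZMod.castHom_surjective _
  have key0 : ∀ x : ZMod 4, φ x = 0 → ∃ y, x = 2 * y := by rw [hφ]; decide
  have key2 : ∀ x : ZMod 4, 2 * x = 0 → φ x = 0 := by rw [hφ]; decide
  have lift0 : ∀ f : (ZMod 4)[X], f.map φ = 0 → ∃ w, f = 2 * w := by
    intro f hf
    have : ∀ i, ∃ y, f.coeff i = 2 * y := fun i => key0 _ (by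
      rw [← coeff_map, hf, coeff_zero])
    choose y hy using this
    refine ⟨∑ i ∈ f.support, monomial i (y i), ?_⟩
    conv_lhs => rw [f.as_sum_support]
    rw [Finset.mul_sum]
    refine Finset.sum_congr rfl fun i _ => ?_
    rw [hy i, ← C_mul_monomial]; rfl
  have lift2 : ∀ f : (ZMod 4)[X], 2 * f = 0 → f.map φ = 0 := by
    intro f hf
    ext i
    rw [coeff_map, coeff_zero]
    refine key2 _ ?_
    have := congrArg (fun p => coeff p i) hf
    simpa using this
  have mapsurj : Function.Surjective (Polynomial.map φ) := Polynomial.map_surjective φ hφsurj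
  have h4' : (4 : ZMod 4) = 0 := by decide
  have h4 : (4 : R) = 0 := by
    have := congrArg (algebraMap (ZMod 4) R) h4'
    rwa [map_ofNat, map_zero] at this
  have h4A : (4 : AdjoinRoot h) = 0 := by
    have := congrArg (algebraMap (ZMod 4) (AdjoinRoot h)) h4'
    rwa [map_ofNat, map_zero] at this
  have hmap2 : ∀ w : (ZMod 4)[X], (2 * w).map φ = 0 := by
    intro w
    rw [Polynomial.map_mul, show (2 : (ZMod 4)[X]).map φ = 0 by
      rw [Polynomial.map_ofNat]; exact congrArg C (by decide : (2 : ZMod 2) = 0) |>.trans C_0,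
      zero_mul]
  have hnt : Nontrivial (AdjoinRoot h) := by
    refine ⟨⟨1, 0, fun h1 => ?_⟩⟩
    rw [← map_one (AdjoinRoot.mk h), AdjoinRoot.mk_eq_zero] at h1
    refine hirr.not_isUnit (isUnit_of_dvd_one ?_)
    obtain ⟨q, hq⟩ := h1
    exact ⟨q.map φ, by rw [← Polynomial.map_mul, ← hq, Polynomial.map_one]⟩
  have hann : ∀ x : AdjoinRoot h, 2 * x = 0 → 2 ∣ x := by
    intro x hx
    obtain ⟨f, rfl⟩ := AdjoinRoot.mk_surjective x
    have hx' : AdjoinRoot.mk h (2 * f) = 0 := by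
      rwa [map_mul, map_ofNat]
    rw [AdjoinRoot.mk_eq_zero] at hx'
    obtain ⟨q, hq⟩ := hx'
    have hq0 : h.map φ * q.map φ = 0 := by
      rw [← Polynomial.map_mul, ← hq, hmap2]
    obtain ⟨q', rfl⟩ := lift0 q ((mul_eq_zero.1 hq0).resolve_left hirr.ne_zero)
    obtain ⟨w, hw⟩ := lift0 _ (lift2 (f - h * q') (by linear_combination hq))
    refine ⟨AdjoinRoot.mk h w, ?_⟩
    have := congrArg (AdjoinRoot.mk h) hw
    simpa [map_ofNat] using this
  have hunit : ∀ x : AdjoinRoot h, ¬ 2 ∣ x → IsUnit x := by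
    intro x hx
    obtain ⟨f, rfl⟩ := AdjoinRoot.mk_surjective x
    have hnd : ¬ h.map φ ∣ f.map φ := by
      rintro ⟨q, hq⟩
      obtain ⟨q, rfl⟩ := mapsurj q
      obtain ⟨w, hw⟩ := lift0 (f - h * q) (by
        rw [Polynomial.map_sub, Polynomial.map_mul, hq, sub_self])
      refine hx ⟨AdjoinRoot.mk h w, ?_⟩
      have := congrArg (AdjoinRoot.mk h) hw
      simpa [map_ofNat] using this
    obtain ⟨a, b, hab⟩ := (hirr.coprime_iff_not_dvd).2 hnd
    obtain ⟨a, rfl⟩ := mapsurj a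
    obtain ⟨b, rfl⟩ := mapsurj b
    obtain ⟨w, hw⟩ := lift0 (a * h + b * f - 1) (by
      simp only [Polynomial.map_sub, Polynomial.map_add, Polynomial.map_mul, Polynomial.map_one,
        hab, sub_self])
    have h1 := congrArg (AdjoinRoot.mk h) hw
    have h2 : AdjoinRoot.mk h b * AdjoinRoot.mk h f = 1 + 2 * AdjoinRoot.mk h w := by
      simp only [map_sub, map_add, map_mul, AdjoinRoot.mk_self, map_one, map_ofNat, mul_zero,
        zero_add] at h1
      linear_combination h1
    exact isUnit_of_mul_isUnit_right (h2 ▸ isUnit_one_add_two_mul h4A _)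
  have he2 : e 2 = 2 := map_ofNat e 2
  have hdvd : ∀ x : R, 2 ∣ e x → 2 ∣ x := by
    rintro x ⟨y, hy⟩
    exact ⟨e.symm y, e.injective (by rw [map_mul, he2, hy, AlgEquiv.apply_symm_apply])⟩
  exact
    { toNontrivial := e.toEquiv.nontrivial
      four_eq_zero := h4
      two_dvd_of_two_mul_eq_zero := fun x hx => hdvd x (hann _ (by
        rw [← he2, ← map_mul, hx, map_zero]))
      isUnit_of_not_two_dvd := fun x hx =>
        (MulEquiv.isUnit_map e).1 (hunit _ fun hd => hx (hdvd x hd)) }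

variable {R : Type} [CommRing R]

theorem red_eq_zero_iff {x : R} : red R x = 0 ↔ 2 ∣ x := by
  rw [Ideal.Quotient.eq_zero_iff_mem, Ideal.mem_span_singleton]

theorem residue_two_eq_zero : (2 : Residue R) = 0 := by
  rw [← map_ofNat (red R) 2, red_eq_zero_iff]

theorem map_red_eq_zero_iff {p : R[X]} : p.map (red R) = 0 ↔ 2 ∣ p := by
  constructor
  · intro h
    rw [show (2 : R[X]) = C 2 from rfl, C_dvd_iff_dvd_coeff]
    intro i
    rw [← red_eq_zero_iff, ← coeff_map, h, coeff_zero]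
  · rintro ⟨q, rfl⟩
    rw [Polynomial.map_mul, Polynomial.map_ofNat,
      show (OfNat.ofNat 2 : (Residue R)[X]) = C 2 from rfl, residue_two_eq_zero, C_0, zero_mul]

variable [IsGR4 R]

theorem two_mul_two_mul (x : R) : 2 * (2 * x) = 0 := by
  linear_combination x * (four_eq_zero (R := R))

theorem two_ne_zero : (2 : R) ≠ 0 := by
  intro h
  obtain ⟨y, hy⟩ := two_dvd_of_two_mul_eq_zero (1 : R) (by rw [h, zero_mul])
  rw [h, zero_mul] at hy
  exact one_ne_zero hy

theorem isUnit_iff {x : R} : IsUnit x ↔ ¬ 2 ∣ x := by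
  refine ⟨?_, isUnit_of_not_two_dvd x⟩
  rintro hx ⟨y, rfl⟩
  exact two_ne_zero ((hx.mul_left_eq_zero).1 (by linear_combination y * (four_eq_zero (R := R))))

theorem two_mul_eq_zero_iff {x : R} : 2 * x = 0 ↔ 2 ∣ x :=
  ⟨two_dvd_of_two_mul_eq_zero x, by rintro ⟨y, rfl⟩; exact two_mul_two_mul y⟩

theorem not_isUnit_two : ¬ IsUnit (2 : R) := fun h => isUnit_iff.1 h dvd_rfl

theorem eq_zero_or_two_mul_or_isUnit (x : R) : x = 0 ∨ (∃ c, IsUnit c ∧ x = 2 * c) ∨ IsUnit x := by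
  by_cases h : 2 ∣ x
  · obtain ⟨c, rfl⟩ := h
    by_cases hc : 2 ∣ c
    · exact .inl (two_mul_eq_zero_iff.2 hc)
    · exact .inr (.inl ⟨c, isUnit_iff.2 hc, rfl⟩)
  · exact .inr (.inr (isUnit_iff.2 h))

/-- `R` is a chain ring. -/
theorem dvd_total (x y : R) : x ∣ y ∨ y ∣ x := by
  rcases eq_zero_or_two_mul_or_isUnit x with rfl | ⟨c, hc, rfl⟩ | hx
  · exact .inr (dvd_zero y)
  · by_cases hy : 2 ∣ y
    · exact .inl ((hc.mul_right_dvd).2 hy)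
    · exact .inr ((isUnit_iff.2 hy).dvd)
  · exact .inl hx.dvd

theorem isUnit_iff_red_ne_zero {x : R} : IsUnit x ↔ red R x ≠ 0 := by
  rw [isUnit_iff, Ne, red_eq_zero_iff]

instance : IsDomain (Residue R) := by
  have : (Ideal.span {(2 : R)}).IsPrime := by
    refine ⟨fun h => not_isUnit_two (Ideal.span_singleton_eq_top.1 h), fun {x y} h => ?_⟩
    simp only [Ideal.mem_span_singleton] at h ⊢
    by_contra! hxy
    exact isUnit_iff.1 ((isUnit_iff.2 hxy.1).mul (isUnit_iff.2 hxy.2)) h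
  exact Ideal.Quotient.isDomain _

instance : CharP (Residue R) 2 :=
  CharTwo.of_one_ne_zero_of_two_eq_zero one_ne_zero residue_two_eq_zero

theorem poly_two_mul_eq_zero_iff {p : R[X]} : 2 * p = 0 ↔ p.map (red R) = 0 := by
  constructor
  · intro h
    ext i
    rw [coeff_map, coeff_zero, red_eq_zero_iff]
    refine two_dvd_of_two_mul_eq_zero _ ?_
    simpa using congrArg (fun p => coeff p i) h
  · rw [map_red_eq_zero_iff]
    rintro ⟨q, rfl⟩
    have h4 : (4 : R[X]) = 0 := by
      have := congrArg C (four_eq_zero (R := R)); rwa [C_0] at this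
    linear_combination q * h4

end IsGR4

end

section

/-! ### Pairs of polynomials as polynomials -/

variable {R : Type} [CommRing R]

/-- The polynomial `a(x²) + x b(x²)` attached to the pair `[a, b]`.  The order `<_{-1}` compares
terms of pairs by the degrees of the corresponding monomials, so leading terms and coefficients
of pairs become degrees and leading coefficients of polynomials. -/
def interleave (p : R[X] × R[X]) : R[X] := expand R 2 p.1 + X * expand R 2 p.2

theorem coeff_interleave_even (p : R[X] × R[X]) (i : ℕ) :
    (interleave p).coeff (2 * i) = p.1.coeff i := by
  rw [interleave, coeff_add, coeff_expand_mul' two_pos]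
  rcases i with _ | i
  · simp
  · rw [show 2 * (i + 1) = 2 * i + 1 + 1 by ring, coeff_X_mul, coeff_expand two_pos,
      if_neg (by omega), add_zero]

theorem coeff_interleave_odd (p : R[X] × R[X]) (i : ℕ) :
    (interleave p).coeff (2 * i + 1) = p.2.coeff i := by
  rw [interleave, coeff_add, coeff_X_mul, coeff_expand_mul' two_pos, coeff_expand two_pos,
    if_neg (by omega), zero_add]

theorem interleave_injective : Function.Injective (interleave : R[X] × R[X] → R[X]) := by
  intro p q h
  refine Prod.ext (Polynomial.ext fun i => ?_) (Polynomial.ext fun i => ?_)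
  · rw [← coeff_interleave_even, h, coeff_interleave_even]
  · rw [← coeff_interleave_odd, h, coeff_interleave_odd]

@[simp] theorem interleave_zero : interleave (0 : R[X] × R[X]) = 0 := by simp [interleave]

theorem interleave_eq_zero_iff {p : R[X] × R[X]} : interleave p = 0 ↔ p = 0 := by
  rw [← interleave_zero, interleave_injective.eq_iff]

theorem interleave_sub (p q : R[X] × R[X]) :
    interleave (p - q) = interleave p - interleave q := by
  simp only [interleave, Prod.fst_sub, Prod.snd_sub, map_sub]; ring

theorem interleave_smul (c : R[X]) (p : R[X] × R[X]) :
    interleave (c • p) = expand R 2 c * interleave p := by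
  simp only [interleave, Prod.smul_fst, Prod.smul_snd, smul_eq_mul, map_mul]; ring

/-- The degree of the monomial attached to a term of `R[z]²`. -/
def termRank : PairTerm → ℕ
  | .inl i => 2 * i
  | .inr j => 2 * j + 1

theorem termRank_injective : Function.Injective termRank := by
  rintro (i | i) (j | j) h <;> simp only [termRank] at h
  · rw [show i = j by omega]
  · omega
  · omega
  · rw [show i = j by omega]

theorem termLT_iff (a b : PairTerm) : termLT (-1) a b ↔ termRank a < termRank b := by
  rcases a with i | i <;> rcases b with j | j <;> simp only [termLT, termRank] <;> omega

theorem termDvd_iff (a b : PairTerm) :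
    termDvd a b ↔ ∃ k, termRank b = termRank a + 2 * k := by
  rcases a with i | i <;> rcases b with j | j <;> simp only [termDvd, termRank]
  · exact ⟨fun h => ⟨j - i, by omega⟩, fun ⟨k, hk⟩ => by omega⟩
  · exact ⟨False.elim, fun ⟨k, hk⟩ => by omega⟩
  · exact ⟨False.elim, fun ⟨k, hk⟩ => by omega⟩
  · exact ⟨fun h => ⟨j - i, by omega⟩, fun ⟨k, hk⟩ => by omega⟩

open Classical in
theorem natDegree_interleave (p : R[X] × R[X]) :
    (interleave p).natDegree = if p.2.degree < p.1.degree then 2 * p.1.natDegree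
      else if p.2 = 0 then 0 else 2 * p.2.natDegree + 1 := by
  have hX : (X * expand R 2 p.2).degree = if p.2 = 0 then ⊥ else ((2 * p.2.natDegree + 1 : ℕ) :
      WithBot ℕ) := by
    split_ifs with h
    · simp [h]
    · have : Nontrivial R := nontrivial_of_ne _ _ (leadingCoeff_ne_zero.2 h)
      rw [mul_comm, degree_mul_X, degree_eq_natDegree ((expand_ne_zero two_pos).2 h),
        natDegree_expand, mul_comm p.2.natDegree]; rfl
  have hE : (expand R 2 p.1).degree = if p.1 = 0 then ⊥ else ((2 * p.1.natDegree : ℕ) :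
      WithBot ℕ) := by
    split_ifs with h
    · simp [h]
    · rw [degree_eq_natDegree ((expand_ne_zero two_pos).2 h), natDegree_expand, mul_comm]
  rw [interleave]
  split_ifs with h1 h2
  · have h0 : p.1 ≠ 0 := by rintro h; simp [h] at h1
    rw [natDegree_add_eq_left_of_degree_lt, natDegree_expand, mul_comm]
    rw [hX, hE, if_neg h0]
    split_ifs with h3
    · exact WithBot.bot_lt_coe _
    · rw [degree_eq_natDegree h0, degree_eq_natDegree h3, Nat.cast_lt] at h1
      exact_mod_cast by omega
  · have : p.1 = 0 := by simpa [h2] using h1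
    simp [h2, this]
  · rw [natDegree_add_eq_right_of_degree_lt, natDegree_eq_of_degree_eq_some (by rw [hX, if_neg h2])]
    rw [hX, hE, if_neg h2]
    split_ifs with h3
    · exact WithBot.bot_lt_coe _
    · rw [degree_eq_natDegree h2, degree_eq_natDegree h3, Nat.cast_lt] at h1
      exact_mod_cast by omega

theorem termRank_leadTerm {p : R[X] × R[X]} (hp : p ≠ 0) :
    termRank (leadTerm (-1) p) = (interleave p).natDegree := by
  rw [natDegree_interleave, leadTerm]
  by_cases h1 : p.1 = 0
  · have h2 : p.2 ≠ 0 := fun h => hp (Prod.ext h1 h)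
    rw [h1, degree_zero, degree_eq_natDegree h2, if_neg (by simp), if_neg h2]
    rfl
  · by_cases h2 : p.2 = 0
    · rw [h2, degree_zero, degree_eq_natDegree h1, if_pos]
      · rfl
      · exact WithBot.bot_lt_coe _
    · rw [degree_eq_natDegree h1, degree_eq_natDegree h2, if_neg h2]
      change termRank (if ((p.2.natDegree : ℕ) : ℤ) ≤ (p.1.natDegree : ℤ) + -1 then _ else _) = _
      simp only [Nat.cast_lt]
      split_ifs <;> first | rfl | omega

theorem leadCoeff_eq (p : R[X] × R[X]) :
    leadCoeff (-1) p = (interleave p).leadingCoeff := by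
  by_cases hp : p = 0
  · subst hp
    rw [interleave_zero, leadingCoeff_zero, leadCoeff]
    split <;> simp
  rw [leadingCoeff, ← termRank_leadTerm hp, leadCoeff]
  split <;> rename_i h <;> rw [h]
  · exact (coeff_interleave_even p _).symm
  · exact (coeff_interleave_odd p _).symm

theorem natDegree_interleave_le {p : R[X] × R[X]} {d : ℕ} (h1 : 2 * p.1.natDegree ≤ d)
    (h2 : p.2 = 0 ∨ 2 * p.2.natDegree + 1 ≤ d) : (interleave p).natDegree ≤ d := by
  rw [natDegree_interleave]
  split_ifs with h h' <;> [exact h1; exact Nat.zero_le _; exact h2.resolve_left h']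

theorem natDegree_fst_le (p : R[X] × R[X]) : 2 * p.1.natDegree ≤ (interleave p).natDegree := by
  rcases eq_or_ne p.1 0 with h | h
  · simp [h]
  · refine le_natDegree_of_ne_zero ?_
    rwa [coeff_interleave_even, coeff_natDegree, leadingCoeff_ne_zero]

theorem natDegree_snd_le {p : R[X] × R[X]} (h : p.2 ≠ 0) :
    2 * p.2.natDegree + 1 ≤ (interleave p).natDegree := by
  refine le_natDegree_of_ne_zero ?_
  rwa [coeff_interleave_odd, coeff_natDegree, leadingCoeff_ne_zero]

theorem map_interleave {S : Type} [CommRing S] (φ : R →+* S) (p : R[X] × R[X]) :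
    (interleave p).map φ = interleave (p.1.map φ, p.2.map φ) := by
  simp [interleave, map_expand]

end

section

/-! ### Values of the counted computations -/

namespace Counted

variable {A B S : Type}

theorem pure_val (a : A) : (pure a : Counted A).val = a := rfl

theorem bind_val (x : Counted A) (f : A → Counted B) : (x >>= f).val = (f x.val).val := rfl

theorem loop_val_succ (step : ℕ → S → Counted S) (s : S) (N : ℕ) :
    (loop step s (N + 1)).val = (step N (loop step s N).val).val := rfl

variable [CommRing A]

theorem sum_val (N : ℕ) (f : ℕ → Counted A) :
    (Counted.sum N f).val = ∑ i ∈ Finset.range N, (f i).val := by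
  induction N with
  | zero => rfl
  | succ N ih => rw [Finset.sum_range_succ, ← ih]; rfl

theorem ofCoeffs_coeff (N : ℕ) (f : ℕ → Counted A) (i : ℕ) :
    (ofCoeffs N f).val.coeff i = if i < N then (f i).val else 0 := by
  simp [ofCoeffs, coeff_monomial]

theorem ofCoeffs_val_eq {N : ℕ} {f : ℕ → Counted A} {p : A[X]}
    (h : ∀ i < N, (f i).val = p.coeff i) (hp : ∀ i, N ≤ i → p.coeff i = 0) :
    (ofCoeffs N f).val = p := by
  ext i
  rw [ofCoeffs_coeff]
  split_ifs with hi
  · exact h i hi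
  · exact (hp i (by omega)).symm

theorem horner_val (N : ℕ) (f : ℕ → A) (x : A) :
    (horner N f x).val = ∑ i ∈ Finset.range N, f i * x ^ i := by
  have key : ∀ k ≤ N, (loop (fun i s => do
      let y ← mul s x
      add y (f (N - 1 - i))) 0 k).val = ∑ i ∈ Finset.range k, f (N - k + i) * x ^ i := by
    intro k
    induction k with
    | zero => intro _; rfl
    | succ k ih =>
      intro hk
      rw [loop_val_succ, ih (by omega)]
      change (∑ i ∈ Finset.range k, f (N - k + i) * x ^ i) * x + f (N - 1 - k) = _
      rw [Finset.sum_range_succ', Finset.sum_mul]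
      congr 1
      · refine Finset.sum_congr rfl fun i _ => ?_
        rw [show N - (k + 1) + (i + 1) = N - k + i by omega]; ring
      · rw [show N - (k + 1) + 0 = N - 1 - k by omega]; ring
  refine (key N le_rfl).trans ?_
  simp

theorem horner_coeff_val {N : ℕ} {f : A[X]} (hf : ∀ i, N ≤ i → f.coeff i = 0) (x : A) :
    (horner N f.coeff x).val = f.eval x := by
  rw [horner_val, eval_eq_sum_range' (n := max N (f.natDegree + 1)) (by omega)]
  refine Finset.sum_subset (by simp) fun i _ hi => ?_
  rw [hf i (by simpa using hi), zero_mul]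

theorem geometric_val (a b : A) (N i : ℕ) (hi : i < N) :
    (geometric a b N).val i = a * b ^ i := by
  have key : ∀ k, (∀ i < k, (loop (fun i (r : (ℕ → A) × A) => do
      let y ← mul r.2 b
      pure (Function.update r.1 i r.2, y)) (fun _ => 0, a) k).val.1 i = a * b ^ i) ∧
      (loop (fun i (r : (ℕ → A) × A) => do
      let y ← mul r.2 b
      pure (Function.update r.1 i r.2, y)) (fun _ => 0, a) k).val.2 = a * b ^ k := by
    intro k
    induction k with
    | zero => exact ⟨fun i hi => absurd hi (Nat.not_lt_zero i), (by simp [loop, pure_val])⟩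
    | succ k ih =>
      rw [loop_val_succ]
      set r := (loop (fun i (r : (ℕ → A) × A) => do
        let y ← mul r.2 b
        pure (Function.update r.1 i r.2, y)) (fun _ => 0, a) k).val
      change (∀ i < k + 1, Function.update r.1 k r.2 i = _) ∧ r.2 * b = _
      refine ⟨fun i hi => ?_, by rw [ih.2]; ring⟩
      rcases eq_or_ne i k with rfl | hik
      · rw [Function.update_self, ih.2]
      · rw [Function.update_of_ne hik, ih.1 i (by omega)]
  exact (key N).1 i hi

theorem div_val {a b : A} (h : b ∣ a) : a = b * (div a b).val := by
  simp only [div, dif_pos h]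
  exact h.choose_spec

theorem isZero_val (a : A) : (isZero a).val = true ↔ a = 0 := by
  simp [isZero]

theorem isMultiple_val (a b : A) : (isMultiple a b).val = true ↔ b ∣ a := by
  simp [isMultiple]

end Counted

variable {R : Type} [CommRing R]

theorem findDegree_val {N : ℕ} {f : R[X]} (hf : ∀ i, N ≤ i → f.coeff i = 0) :
    (findDegree N f).val = f.degree := by
  have key : ∀ k, (findDegree k f).val =
      (∑ i ∈ Finset.range k, monomial i (f.coeff i)).degree := by
    intro k
    induction k with
    | zero => simp [findDegree, loop, pure_val]
    | succ k ih =>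
      rw [Finset.sum_range_succ, findDegree, loop_val_succ]
      change (if (isZero (f.coeff k)).val then (findDegree k f).val else (k : WithBot ℕ)) = _
      by_cases h : f.coeff k = 0
      · rw [if_pos ((isZero_val _).2 h), ih, h, monomial_zero_right, add_zero]
      · rw [if_neg (fun h' => h ((isZero_val _).1 h')), degree_add_eq_right_of_degree_lt,
          degree_monomial k h]
        rw [degree_monomial k h, degree_lt_iff_coeff_zero]
        intro m hm
        simp [coeff_monomial]
        omega
  rw [key]
  congr 1
  ext i
  simp only [finsetSum_coeff, coeff_monomial, Finset.sum_ite_eq', Finset.mem_range]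
  split_ifs with h
  · rfl
  · exact (hf i (by omega)).symm

theorem findLeadTerm_val {ℓ : ℤ} {N : ℕ} {p : R[X] × R[X]}
    (h1 : p.1.natDegree < N) (h2 : p.2.natDegree < N) :
    (findLeadTerm ℓ N p).val = leadTerm ℓ p := by
  change leadTermOfDegrees ℓ (findDegree N p.1).val (findDegree N p.2).val = _
  rw [findDegree_val fun i hi => coeff_eq_zero_of_natDegree_lt (by omega),
    findDegree_val fun i hi => coeff_eq_zero_of_natDegree_lt (by omega)]
  rfl

theorem discrepancy_val (U : R[X]) (k : ℕ) (p : R[X] × R[X]) :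
    (discrepancy U k p).val = (p.1 * U - p.2).coeff k := by
  change (Counted.sum (k + 1) fun i => mul (p.1.coeff i) (U.coeff (k - i))).val - p.2.coeff k = _
  rw [sum_val, coeff_sub, coeff_mul, Finset.Nat.sum_antidiagonal_eq_sum_range_succ_mk]
  rfl

theorem subMul_val {N : ℕ} {f g : R[X]} (x : R) (hf : f.natDegree < N) (hg : g.natDegree < N) :
    (subMul N f x g).val = f - C x * g := by
  refine ofCoeffs_val_eq (fun i _ => ?_) fun i hi => ?_
  · rw [coeff_sub, coeff_C_mul]; rfl
  · rw [coeff_sub, coeff_C_mul, coeff_eq_zero_of_natDegree_lt (by omega),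
      coeff_eq_zero_of_natDegree_lt (by omega), mul_zero, sub_zero]

theorem isRegularPoly_val {N : ℕ} {f : R[X]} (hf : f.natDegree < N) :
    (isRegularPoly N f).val = true ↔ ¬ (2 : R[X]) ∣ f := by
  have key : ∀ k, (isRegularPoly k f).val = true ↔ ∃ i < k, ¬ (2 : R) ∣ f.coeff i := by
    intro k
    induction k with
    | zero => simp [isRegularPoly, loop, pure_val]
    | succ k ih =>
      rw [isRegularPoly, loop_val_succ]
      change ((isRegularPoly k f).val || !(isMultiple (f.coeff k) 2).val) = true ↔ _
      rw [Bool.or_eq_true, ih, Bool.not_eq_true', ← Bool.not_eq_true, isMultiple_val]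
      simp only [Nat.lt_succ_iff_lt_or_eq, or_and_right, exists_or, exists_eq_left]
  rw [key, show (2 : R[X]) = C 2 from rfl, C_dvd_iff_dvd_coeff, not_forall]
  refine ⟨fun ⟨i, _, h⟩ => ⟨i, h⟩, fun ⟨i, h⟩ => ⟨i, ?_, h⟩⟩
  by_contra hi
  exact h (by rw [coeff_eq_zero_of_natDegree_lt (by omega)]; exact dvd_zero _)

/-! ### Solution by Approximations -/

/-- The discrepancy of `[f, g]` at `zᵏ`, the coefficient of `zᵏ` in `f U - g`. -/
def disc (U : R[X]) (k : ℕ) (p : R[X] × R[X]) : R := (p.1 * U - p.2).coeff k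

theorem disc_sub (U : R[X]) (k : ℕ) (p q : R[X] × R[X]) :
    disc U k (p - q) = disc U k p - disc U k q := by
  simp only [disc, ← coeff_sub, Prod.fst_sub, Prod.snd_sub]; congr 1; ring

theorem disc_C_smul (U : R[X]) (k : ℕ) (x : R) (p : R[X] × R[X]) :
    disc U k (C x • p) = x * disc U k p := by
  simp only [disc, ← coeff_C_mul, Prod.smul_fst, Prod.smul_snd, smul_eq_mul]; congr 1; ring

theorem mem_solutionModule {U : R[X]} {k : ℕ} {p : R[X] × R[X]} :
    p ∈ solutionModule U k ↔ X ^ k ∣ p.1 * U - p.2 := Iff.rfl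

theorem mem_solutionModule_succ {U : R[X]} {k : ℕ} {p : R[X] × R[X]} :
    p ∈ solutionModule U (k + 1) ↔ p ∈ solutionModule U k ∧ disc U k p = 0 := by
  simp only [mem_solutionModule, X_pow_dvd_iff, Nat.lt_succ_iff_lt_or_eq, or_imp, forall_and,
    forall_eq, disc]

theorem disc_X_mul {U : R[X]} {k : ℕ} {p : R[X] × R[X]} (c : R[X])
    (hp : p ∈ solutionModule U k) : disc U k ((X * c) • p) = 0 := by
  obtain ⟨q, hq⟩ := hp
  rw [disc, show ((X * c) • p).1 * U - ((X * c) • p).2 = X ^ (k + 1) * (c * q) by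
    simp only [Prod.smul_fst, Prod.smul_snd, smul_eq_mul]
    linear_combination X * c * hq, coeff_X_pow_mul', if_neg (by omega)]

/-- What Solution by Approximations maintains.  Over the chain ring `R` a strong form of the
Gröbner property is convenient: every leading monomial is a unit times a power of `z` times one
of the four leading monomials. -/
structure ApproxInvariant (U : R[X]) (k : ℕ) (B : Fin 4 → R[X] × R[X]) : Prop where
  mem : ∀ i, B i ∈ solutionModule U k
  natDegree_le : ∀ i, (B i).1.natDegree ≤ k ∧ (B i).2.natDegree ≤ k
  leadingCoeff : ∀ i, (interleave (B i)).leadingCoeff = ![1, 2, 1, 2] i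
  parity : ∀ i, (interleave (B i)).natDegree % 2 = ![0, 0, 1, 1] i
  strong : ∀ q ∈ solutionModule U k, q ≠ 0 → ∃ i e, ∃ c, IsUnit c ∧
    (interleave q).natDegree = (interleave (B i)).natDegree + 2 * e ∧
    (interleave q).leadingCoeff = c * (interleave (B i)).leadingCoeff

/-- Subtracting the monomial multiple of `q` with the leading monomial of `p` cancels the latter. -/
theorem sub_monomial_mul_eq_zero_or_natDegree_lt {A : Type} [CommRing A] {p q : A[X]} {e : ℕ}
    {c : A} (hd : p.natDegree = q.natDegree + e) (hc : p.leadingCoeff = c * q.leadingCoeff) :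
    p - C c * X ^ e * q = 0 ∨ (p - C c * X ^ e * q).natDegree < p.natDegree := by
  by_cases h0 : p.natDegree = 0
  · left
    have hq : q.natDegree = 0 := by omega
    have he : e = 0 := by omega
    rw [leadingCoeff, leadingCoeff, h0, hq] at hc
    rw [eq_C_of_natDegree_eq_zero h0, eq_C_of_natDegree_eq_zero hq, hc, he]
    simp
  · right
    have hle : (p - C c * X ^ e * q).natDegree ≤ p.natDegree := by
      refine (natDegree_sub_le _ _).trans (max_le le_rfl ?_)
      rw [mul_assoc]
      refine (natDegree_C_mul_le _ _).trans ((natDegree_mul_le).trans ?_)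
      have := natDegree_X_pow_le (R := A) e
      omega
    refine lt_of_le_of_ne hle fun h => h0 ?_
    have hz : (p - C c * X ^ e * q).coeff p.natDegree = 0 := by
      rw [coeff_sub, mul_assoc, coeff_C_mul, hd, coeff_X_pow_mul, ← hd, coeff_natDegree,
        coeff_natDegree, hc, sub_self]
    rw [← h, coeff_natDegree, leadingCoeff_eq_zero] at hz
    rw [← h, hz, natDegree_zero]

variable [IsGR4 R] {U : R[X]} {k : ℕ} {B : Fin 4 → R[X] × R[X]}

/-- A solution modulo `zᵏ` with nonzero discrepancy forces a basis element with a leading term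
that is not larger and a discrepancy that divides it. -/
theorem ApproxInvariant.exists_pivot (hB : ApproxInvariant U k B) {q : R[X] × R[X]}
    (hq : q ∈ solutionModule U k) (hD : disc U k q ≠ 0) :
    ∃ j, (interleave (B j)).natDegree ≤ (interleave q).natDegree ∧
      disc U k (B j) ∣ disc U k q := by
  induction hn : (interleave q).natDegree using Nat.strong_induction_on generalizing q with
  | _ n ih =>
  subst hn
  have hq0 : q ≠ 0 := by rintro rfl; simp [disc] at hD
  obtain ⟨i, e, c, -, hdeg, hlc⟩ := hB.strong q hq hq0
  -- the remainder of `q` on division by the basis element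
  set q' := q - (C c * X ^ e) • B i with hq'
  have hmem : q' ∈ solutionModule U k := sub_mem hq (Submodule.smul_mem _ _ (hB.mem i))
  have hint : interleave q' = interleave q - C c * X ^ (2 * e) * interleave (B i) := by
    rw [hq', interleave_sub, interleave_smul, map_mul, expand_C, map_pow, expand_X, ← pow_mul]
  have hlt : disc U k q' ≠ 0 → (interleave q').natDegree < (interleave q).natDegree := by
    intro h
    rcases sub_monomial_mul_eq_zero_or_natDegree_lt hdeg hlc with h0 | h0
    · rw [← hint, interleave_eq_zero_iff] at h0
      rw [h0] at h
      simp [disc] at h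
    · rwa [hint]
  rcases e with _ | e
  · have hD' : disc U k q' = disc U k q - c * disc U k (B i) := by
      rw [hq', disc_sub, pow_zero, mul_one, disc_C_smul]
    by_cases hdvd : disc U k (B i) ∣ disc U k q
    · exact ⟨i, by omega, hdvd⟩
    have hne : disc U k q' ≠ 0 := fun h => hdvd ⟨c, by linear_combination h - hD'⟩
    obtain ⟨j, hj, hjd⟩ := ih _ (hlt hne) hmem hne rfl
    refine ⟨j, hj.trans (hlt hne).le, ?_⟩
    rw [hD'] at hjd
    rcases IsGR4.dvd_total (disc U k (B j)) (disc U k (B i)) with h | h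
    · exact (dvd_sub_left (h.mul_left c)).1 hjd
    · exact absurd ((dvd_sub_left (Dvd.intro_left c rfl)).1 (h.trans hjd)) hdvd
  · have hD' : disc U k q' = disc U k q := by
      rw [hq', disc_sub, show C c * X ^ (e + 1) = X * (C c * X ^ e) by ring,
        disc_X_mul _ (hB.mem i), sub_zero]
    have hne : disc U k q' ≠ 0 := by rwa [hD']
    obtain ⟨j, hj, hjd⟩ := ih _ (hlt hne) hmem hne rfl
    exact ⟨j, hj.trans (hlt hne).le, by rwa [hD'] at hjd⟩

end

section

variable {R : Type} [CommRing R]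

/-- One round either keeps a basis element, or subtracts a multiple of one with a smaller leading
term, or, if no such subtraction is possible, multiplies by `z`. -/
theorem approxStep_val_cases {U : R[X]} {N k : ℕ} {B : Fin 4 → R[X] × R[X]} (hB0 : ∀ i, B i ≠ 0)
    (hB : ∀ i, (B i).1.natDegree < N ∧ (B i).2.natDegree < N) (i : Fin 4) :
    (disc U k (B i) = 0 ∧ (approxStep (-1) U N k B).val i = B i) ∨
    (∃ j x, (interleave (B j)).natDegree < (interleave (B i)).natDegree ∧
      disc U k (B i) = x * disc U k (B j) ∧
      (approxStep (-1) U N k B).val i = B i - C x • B j) ∨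
    ((∀ j, (interleave (B j)).natDegree < (interleave (B i)).natDegree →
        ¬ disc U k (B j) ∣ disc U k (B i)) ∧ disc U k (B i) ≠ 0 ∧
      (approxStep (-1) U N k B).val i = (X : R[X]) • B i) := by
  classical
  set ζ : Fin 4 → R := fun i => (discrepancy U k (B i)).val with hζ
  have hζ' : ∀ i, ζ i = disc U k (B i) := fun i => discrepancy_val U k (B i)
  set τ : Fin 4 → PairTerm := fun i => (findLeadTerm (-1) N (B i)).val with hτ
  have hτ' : ∀ i, termRank (τ i) = (interleave (B i)).natDegree := fun i => by
    rw [hτ, ← termRank_leadTerm (hB0 i)]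
    simp only [findLeadTerm_val (hB i).1 (hB i).2]
  have hval : (approxStep (-1) U N k B).val i =
      (if (isZero (ζ i)).val then (pure (B i) : Counted _) else do
        let pivot ← findPivot (-1) τ ζ i
        match pivot with
        | some j => do
          let x ← div (ζ i) (ζ j)
          let f ← subMul N (B i).1 x (B j).1
          let g ← subMul N (B i).2 x (B j).2
          pure (f, g)
        | none => pure (X * (B i).1, X * (B i).2)).val := rfl
  by_cases h0 : ζ i = 0
  · refine .inl ⟨by rw [← hζ', h0], ?_⟩
    rw [hval, if_pos ((isZero_val _).2 h0)]; rfl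
  rw [hval, if_neg (fun h => h0 ((isZero_val _).1 h)), bind_val]
  set o := (findPivot (-1) τ ζ i).val with ho
  have ho' : o = (List.finRange 4).find? fun j =>
      decide (termLT (-1) (τ j) (τ i)) && decide (ζ j ∣ ζ i) := by
    rw [ho, findPivot]
    simp only [bind_val, pure_val, tabulate, isMultiple]
  rcases hcase : o with _ | j
  · refine .inr (.inr ⟨fun j hj hd => ?_, by rwa [← hζ'], rfl⟩)
    rw [hcase, eq_comm, List.find?_eq_none] at ho'
    refine ho' j (List.mem_finRange j) ?_
    rw [Bool.and_eq_true, decide_eq_true_iff, decide_eq_true_iff, termLT_iff, hτ', hτ', hζ', hζ']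
    exact ⟨hj, hd⟩
  · refine .inr (.inl ⟨j, (div (ζ i) (ζ j)).val, ?_⟩)
    rw [hcase] at ho'
    have hj := List.find?_some ho'.symm
    rw [Bool.and_eq_true, decide_eq_true_iff, decide_eq_true_iff, termLT_iff, hτ', hτ'] at hj
    refine ⟨hj.1, ?_, ?_⟩
    · rw [← hζ', ← hζ', mul_comm]; exact div_val hj.2
    · change ((subMul N (B i).1 _ (B j).1).val, (subMul N (B i).2 _ (B j).2).val) = _
      rw [subMul_val _ (hB i).1 (hB j).1, subMul_val _ (hB i).2 (hB j).2]
      rfl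

theorem leadingCoeff_X_smul (p : R[X] × R[X]) :
    (interleave ((X : R[X]) • p)).leadingCoeff = (interleave p).leadingCoeff := by
  rw [interleave_smul, expand_X, mul_comm, leadingCoeff_mul_X_pow]

theorem natDegree_interleave_sub_C_smul {p q : R[X] × R[X]} (x : R)
    (h : (interleave q).natDegree < (interleave p).natDegree) :
    (interleave (p - C x • q)).natDegree = (interleave p).natDegree ∧
    (interleave (p - C x • q)).leadingCoeff = (interleave p).leadingCoeff := by
  have hlt : (expand R 2 (C x) * interleave q).natDegree < (interleave p).natDegree := by
    rw [expand_C]; exact (natDegree_C_mul_le _ _).trans_lt h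
  rw [interleave_sub, interleave_smul]
  exact ⟨natDegree_sub_eq_left_of_natDegree_lt hlt,
    leadingCoeff_sub_of_degree_lt (degree_lt_degree hlt)⟩

variable [IsGR4 R] {U : R[X]} {k : ℕ} {B : Fin 4 → R[X] × R[X]}

theorem ApproxInvariant.leadingCoeff_ne_zero (hB : ApproxInvariant U k B) (i : Fin 4) :
    (interleave (B i)).leadingCoeff ≠ 0 := by
  rw [hB.leadingCoeff]
  fin_cases i
  exacts [one_ne_zero, IsGR4.two_ne_zero, one_ne_zero, IsGR4.two_ne_zero]

theorem ApproxInvariant.ne_zero (hB : ApproxInvariant U k B) (i : Fin 4) : B i ≠ 0 := by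
  intro h
  exact hB.leadingCoeff_ne_zero i (by rw [h, interleave_zero, leadingCoeff_zero])

theorem natDegree_X_smul {p : R[X] × R[X]} (hp : p ≠ 0) :
    (interleave ((X : R[X]) • p)).natDegree = (interleave p).natDegree + 2 := by
  rw [interleave_smul, expand_X, mul_comm, natDegree_mul_X_pow]
  rwa [Ne, interleave_eq_zero_iff]

/-- One round turns a strong Gröbner basis for `zᵏ` into one for `zᵏ⁺¹`. -/
theorem ApproxInvariant.step (hB : ApproxInvariant U k B) {N : ℕ} (hN : k < N) :
    ApproxInvariant U (k + 1) (approxStep (-1) U N k B).val := by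
  have hcases := approxStep_val_cases (U := U) (N := N) (k := k) hB.ne_zero
    (fun i => ⟨(hB.natDegree_le i).1.trans_lt hN, (hB.natDegree_le i).2.trans_lt hN⟩)
  set B' := (approxStep (-1) U N k B).val
  -- leading coefficients persist, and degrees do not change unless an element is shifted
  have hlc : ∀ i, (interleave (B' i)).leadingCoeff = (interleave (B i)).leadingCoeff := by
    intro i
    rcases hcases i with ⟨-, h⟩ | ⟨j, x, hlt, -, h⟩ | ⟨-, -, h⟩ <;> rw [h]
    · exact (natDegree_interleave_sub_C_smul x hlt).2
    · exact leadingCoeff_X_smul _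
  have hdeg : ∀ i, (interleave (B' i)).natDegree = (interleave (B i)).natDegree ∨
      ((∀ j, (interleave (B j)).natDegree < (interleave (B i)).natDegree →
        ¬ disc U k (B j) ∣ disc U k (B i)) ∧ disc U k (B i) ≠ 0 ∧
      (interleave (B' i)).natDegree = (interleave (B i)).natDegree + 2) := by
    intro i
    rcases hcases i with ⟨-, h⟩ | ⟨j, x, hlt, -, h⟩ | ⟨hno, hne, h⟩
    · rw [h]; exact .inl rfl
    · rw [h]; exact .inl (natDegree_interleave_sub_C_smul x hlt).1
    · rw [h]; exact .inr ⟨hno, hne, natDegree_X_smul (hB.ne_zero i)⟩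
  refine ⟨fun i => ?_, fun i => ?_, fun i => by rw [hlc, hB.leadingCoeff], fun i => ?_, ?_⟩
  · rw [mem_solutionModule_succ]
    rcases hcases i with ⟨h0, h⟩ | ⟨j, x, -, hx, h⟩ | ⟨-, -, h⟩ <;> rw [h]
    · exact ⟨hB.mem i, h0⟩
    · exact ⟨sub_mem (hB.mem i) (Submodule.smul_mem _ _ (hB.mem j)),
        by rw [disc_sub, disc_C_smul, hx, sub_self]⟩
    · refine ⟨Submodule.smul_mem _ _ (hB.mem i), ?_⟩
      simpa using disc_X_mul (1 : R[X]) (hB.mem i)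
  · have hi := hB.natDegree_le i
    rcases hcases i with ⟨h0, h⟩ | ⟨j, x, -, hx, h⟩ | ⟨-, -, h⟩ <;> rw [h]
    · omega
    · have hj := hB.natDegree_le j
      constructor
      · refine (natDegree_sub_le _ _).trans (max_le (by omega) ?_)
        exact (natDegree_C_mul_le _ _).trans (by omega)
      · refine (natDegree_sub_le _ _).trans (max_le (by omega) ?_)
        exact (natDegree_C_mul_le _ _).trans (by omega)
    · have hX := natDegree_X_le (R := R)
      exact ⟨natDegree_mul_le.trans (by omega), natDegree_mul_le.trans (by omega)⟩
  · have := hB.parity i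
    rcases hdeg i with h | ⟨-, -, h⟩ <;> omega
  · intro q hq hq0
    rw [mem_solutionModule_succ] at hq
    obtain ⟨i, e, c, hc, hd, hl⟩ := hB.strong q hq.1 hq0
    rcases hdeg i with h | ⟨hno, hne, h⟩
    · exact ⟨i, e, c, hc, by rw [h, hd], by rw [hl, hlc]⟩
    rcases e with _ | e
    · -- the remainder would be smaller, with a unit multiple of the discrepancy of `B i`
      exfalso
      set q' := q - C c • B i with hq'
      have hD : disc U k q' = -c * disc U k (B i) := by
        rw [hq', disc_sub, disc_C_smul, hq.2]; ring
      have hD0 : disc U k q' ≠ 0 := by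
        rw [hD]; exact fun h => hne ((hc.neg.mul_right_eq_zero).1 h)
      have hlt : (interleave q').natDegree < (interleave q).natDegree := by
        have hint : interleave q' =
            interleave q - C c * X ^ (2 * 0) * interleave (B i) := by
          rw [hq', interleave_sub, interleave_smul, expand_C, mul_zero, pow_zero, mul_one]
        rcases sub_monomial_mul_eq_zero_or_natDegree_lt hd hl with h0 | h0
        · rw [← hint, interleave_eq_zero_iff] at h0
          rw [h0] at hD0
          simp [disc] at hD0
        · rwa [hint]
      obtain ⟨j, hj, hjd⟩ := hB.exists_pivot (q := q')
        (sub_mem hq.1 (Submodule.smul_mem _ _ (hB.mem i))) hD0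
      rw [hD, hc.neg.dvd_mul_left] at hjd
      exact hno j (by omega) hjd
    · exact ⟨i, e, c, hc, by omega, by rw [hl, hlc]⟩

theorem approxInvariant_initial (U : R[X]) :
    ApproxInvariant U 0 ![(1, 0), (2, 0), (0, 1), (0, 2)] := by
  have h2 : (2 : R[X]) = C 2 := rfl
  have hI0 : interleave ((1, 0) : R[X] × R[X]) = 1 := by simp [interleave]
  have hI1 : interleave ((2, 0) : R[X] × R[X]) = C 2 := by simp [interleave, h2]
  have hI2 : interleave ((0, 1) : R[X] × R[X]) = X := by simp [interleave]
  have hI3 : interleave ((0, 2) : R[X] × R[X]) = C 2 * X := by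
    simp only [interleave, h2, expand_C, map_zero]; ring
  have hd3 : (interleave ((0, 2) : R[X] × R[X])).natDegree = 1 := by
    rw [hI3, natDegree_C_mul_X _ (IsGR4.two_ne_zero (R := R))]
  refine ⟨fun i => ?_, fun i => ?_, fun i => ?_, fun i => ?_, ?_⟩
  · simp [mem_solutionModule]
  · rw [h2]; fin_cases i <;> simp
  · fin_cases i
    · simp [hI0]
    · simp [hI1]
    · simp [hI2]
    · simp [hI3]
  · fin_cases i
    · simp [hI0]
    · simp [hI1]
    · simp [hI2]
    · simp [hd3]
  · intro q _ hq0
    have hl0 : (interleave q).leadingCoeff ≠ 0 := by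
      rwa [leadingCoeff_ne_zero, Ne, interleave_eq_zero_iff]
    rcases Nat.even_or_odd' (interleave q).natDegree with ⟨e, he | he⟩ <;>
    rcases IsGR4.eq_zero_or_two_mul_or_isUnit (interleave q).leadingCoeff with h | ⟨c, hc, h⟩ | h
    · exact absurd h hl0
    · refine ⟨1, e, c, hc, ?_, ?_⟩
      · simp [hI1, he]
      · simp [hI1, h, mul_comm]
    · refine ⟨0, e, _, h, ?_, ?_⟩
      · simp [hI0, he]
      · simp [hI0]
    · exact absurd h hl0
    · refine ⟨3, e, c, hc, ?_, ?_⟩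
      · change _ = (interleave ((0, 2) : R[X] × R[X])).natDegree + 2 * e
        rw [hd3, he, add_comm]
      · change _ = c * (interleave ((0, 2) : R[X] × R[X])).leadingCoeff
        rw [hI3, leadingCoeff_mul_X, leadingCoeff_C, h, mul_comm]
    · refine ⟨2, e, _, h, ?_, ?_⟩
      · simp [hI2, he, add_comm]
      · simp [hI2]

theorem approxInvariant_approxBasis (U : R[X]) (r : ℕ) :
    ApproxInvariant U r (approxBasis (-1) U r).val := by
  have key : ∀ k ≤ r, ApproxInvariant U k (loop (approxStep (-1) U (r + 1))
      ![(1, 0), (2, 0), (0, 1), (0, 2)] k).val := by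
    intro k
    induction k with
    | zero => intro _; exact approxInvariant_initial U
    | succ k ih =>
      intro hk
      rw [loop_val_succ]
      exact (ih (by omega)).step (by omega)
  exact key r le_rfl

/-- The strong Gröbner property already forces the order relations between the four leading
terms: apply it to `2 B₀` and `2 B₂`. -/
theorem ApproxInvariant.natDegree_le_of_two_mul (hB : ApproxInvariant U k B) {i j : Fin 4}
    (h : i = 0 ∧ j = 1 ∨ i = 2 ∧ j = 3) :
    (interleave (B j)).natDegree ≤ (interleave (B i)).natDegree := by
  set q := C (2 : R) • B i with hq
  have hi1 : (interleave (B i)).leadingCoeff = 1 := by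
    rw [hB.leadingCoeff]; rcases h with ⟨rfl, -⟩ | ⟨rfl, -⟩ <;> rfl
  have hint : interleave q = C 2 * interleave (B i) := by
    rw [hq, interleave_smul, expand_C]
  have hmon : (interleave (B i)).Monic := hi1
  have hl : (interleave q).leadingCoeff = 2 := by
    rw [hint, leadingCoeff_mul_monic hmon, leadingCoeff_C]
  have hd : (interleave q).natDegree = (interleave (B i)).natDegree := by
    rw [hint, natDegree_C_mul_of_mul_ne_zero]
    rw [hi1, mul_one]; exact IsGR4.two_ne_zero
  have hq0 : q ≠ 0 := by
    intro h0
    rw [h0, interleave_zero, leadingCoeff_zero] at hl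
    exact IsGR4.two_ne_zero hl.symm
  obtain ⟨l, e, c, hc, hde, hlc⟩ := hB.strong q (Submodule.smul_mem _ _ (hB.mem i)) hq0
  have hp0 : _ = 0 := hB.parity 0
  have hp1 : _ = 0 := hB.parity 1
  have hp2 : _ = 1 := hB.parity 2
  have hp3 : _ = 1 := hB.parity 3
  rw [hl, hB.leadingCoeff] at hlc
  have hc2 : c ≠ 2 := by rintro rfl; exact IsGR4.not_isUnit_two hc
  have hlj : l = j := by
    have hc2' : ![1, 2, 1, 2] l ≠ (1 : R) := fun h1 => hc2 (by rw [hlc, h1, mul_one])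
    have hl4 : l = 0 ∨ l = 1 ∨ l = 2 ∨ l = 3 := by omega
    rcases h with ⟨rfl, rfl⟩ | ⟨rfl, rfl⟩ <;> rcases hl4 with rfl | rfl | rfl | rfl <;>
      first | rfl | exact absurd rfl hc2' | omega
  subst hlj
  omega

theorem ApproxInvariant.isStandardGroebnerBasis (hB : ApproxInvariant U k B) :
    IsStandardGroebnerBasis (-1) (solutionModule U k) B := by
  have hrank : ∀ i, termRank (leadTerm (-1) (B i)) = (interleave (B i)).natDegree :=
    fun i => termRank_leadTerm (hB.ne_zero i)
  have hterm : ∀ i e, (interleave (B i)).natDegree = termRank e → leadTerm (-1) (B i) = e :=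
    fun i e h => termRank_injective ((hrank i).trans h)
  have hcoef : ∀ i, leadCoeff (-1) (B i) = ![1, 2, 1, 2] i := fun i => by
    rw [leadCoeff_eq, hB.leadingCoeff]
  have hp0 : _ = 0 := hB.parity 0
  have hp1 : _ = 0 := hB.parity 1
  have hp2 : _ = 1 := hB.parity 2
  have hp3 : _ = 1 := hB.parity 3
  have h10 := hB.natDegree_le_of_two_mul (i := 0) (j := 1) (by simp)
  have h32 := hB.natDegree_le_of_two_mul (i := 2) (j := 3) (by simp)
  refine ⟨⟨?_, fun q hq hq0 => ?_⟩, (interleave (B 0)).natDegree / 2,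
    (interleave (B 1)).natDegree / 2, (interleave (B 2)).natDegree / 2,
    (interleave (B 3)).natDegree / 2, by omega, by omega, ⟨hterm _ _ ?_, hcoef 0⟩,
    ⟨hterm _ _ ?_, hcoef 1⟩, ⟨hterm _ _ ?_, hcoef 2⟩, ⟨hterm _ _ ?_, hcoef 3⟩⟩
  · rintro _ ⟨i, rfl⟩
    exact ⟨hB.mem i, hB.ne_zero i⟩
  · obtain ⟨i, e, c, -, hd, hl⟩ := hB.strong q hq hq0
    refine ⟨B i, ⟨i, rfl⟩, (termDvd_iff _ _).2 ⟨e, ?_⟩, ?_⟩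
    · rw [hrank, termRank_leadTerm hq0, hd]
    · rw [leadCoeff_eq, leadCoeff_eq, hl]; exact Dvd.intro_left c rfl
  all_goals simp only [termRank]; omega

end

section

/-! ### Solutions of the key equation -/

variable {R : Type} [CommRing R]

theorem leadingCoeff_interleave_of_lt {p : R[X] × R[X]} (h : p.2.degree < p.1.degree) :
    (interleave p).leadingCoeff = p.1.leadingCoeff := by
  rw [leadingCoeff, natDegree_interleave, if_pos h, coeff_interleave_even, coeff_natDegree]

theorem leadingCoeff_interleave_of_le {p : R[X] × R[X]} (h : p.1.degree ≤ p.2.degree) :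
    (interleave p).leadingCoeff = p.2.leadingCoeff := by
  by_cases h2 : p.2 = 0
  · have h1 : p.1 = 0 := by simpa [h2] using h
    rw [show p = 0 from Prod.ext h1 h2]; simp
  · rw [leadingCoeff, natDegree_interleave, if_neg h.not_gt, if_neg h2, coeff_interleave_odd,
      coeff_natDegree]

/-- Admissibility in terms of the interleaved polynomial: its degree bounds both components, and its
leading coefficient is the one that has to be a unit. -/
theorem isKeySolution_iff {t : ℕ} {T : R[X]} {p : R[X] × R[X]} :
    IsKeySolution t T p ↔ p ∈ solutionModule (1 + T) (t + 1) ∧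
      (interleave p).natDegree ≤ t + 1 ∧ (2 : R[X]) ∈ Ideal.span {p.1, p.2} ∧
      IsUnit (interleave p).leadingCoeff := by
  constructor
  · rintro ⟨h1, h2, h3, h4, h5, h6⟩
    refine ⟨h1, natDegree_interleave_le h2 (.inr (by omega)), h4, ?_⟩
    rcases lt_or_ge p.2.degree p.1.degree with h | h
    · rw [leadingCoeff_interleave_of_lt h]; exact h5 h
    · rw [leadingCoeff_interleave_of_le h]; exact h6 h
  · rintro ⟨h1, h2, h3, h4⟩
    refine ⟨h1, (natDegree_fst_le p).trans h2, ?_, h3, fun h => ?_, fun h => ?_⟩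
    · by_cases h0 : p.2 = 0
      · simp [h0]
      · have := natDegree_snd_le h0; omega
    · rwa [leadingCoeff_interleave_of_lt h] at h4
    · rwa [leadingCoeff_interleave_of_le h] at h4

/-- Two solutions of small degree are proportional: the congruence
`a b' ≡ a a' U ≡ a' b mod zᵗ⁺¹` is an equation for degree reasons. -/
theorem fst_mul_snd_eq {U : R[X]} {t : ℕ} {p p' : R[X] × R[X]}
    (hp : p ∈ solutionModule U (t + 1)) (hp' : p' ∈ solutionModule U (t + 1))
    (hd : (interleave p).natDegree ≤ t + 1) (hd' : (interleave p').natDegree ≤ t + 1) :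
    p.1 * p'.2 = p.2 * p'.1 := by
  have hbound : ∀ q q' : R[X] × R[X], (interleave q).natDegree ≤ t + 1 →
      (interleave q').natDegree ≤ t + 1 → (q.1 * q'.2).natDegree ≤ t := by
    intro q q' h h'
    by_cases h0 : q'.2 = 0
    · simp [h0]
    · have h1 := natDegree_fst_le q
      have h2 := natDegree_snd_le h0
      exact natDegree_mul_le.trans (by omega)
  obtain ⟨u, hu⟩ := hp
  obtain ⟨u', hu'⟩ := hp'
  have hdvd : X ^ (t + 1) ∣ p.1 * p'.2 - p.2 * p'.1 :=
    ⟨u * p'.1 - u' * p.1, by linear_combination p'.1 * hu - p.1 * hu'⟩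
  rw [← sub_eq_zero]
  have hdeg : (p.1 * p'.2 - p.2 * p'.1).natDegree ≤ t := by
    refine (natDegree_sub_le _ _).trans (max_le (hbound p p' hd hd') ?_)
    rw [mul_comm]; exact hbound p' p hd' hd
  ext i
  rw [coeff_zero]
  rcases le_or_gt i t with hi | hi
  · exact (X_pow_dvd_iff.1 hdvd) i (by omega)
  · exact coeff_eq_zero_of_natDegree_lt (by omega)

theorem map_red_interleave_ne_zero_iff (p : R[X] × R[X]) :
    (interleave p).map (red R) ≠ 0 ↔ ¬ (2 : R[X]) ∣ p.1 ∨ ¬ (2 : R[X]) ∣ p.2 := by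
  rw [map_interleave, Ne, interleave_eq_zero_iff, Prod.mk_eq_zero, IsGR4.map_red_eq_zero_iff,
    IsGR4.map_red_eq_zero_iff, not_and_or]

/-- The minimal regular element is regular and of minimal degree among the regular ones. -/
theorem minimalRegular_spec {N : ℕ} {B : Fin 4 → R[X] × R[X]}
    (hB : ∀ i, (B i).1.natDegree < N ∧ (B i).2.natDegree < N)
    (hreg : ∃ i, (interleave (B i)).map (red R) ≠ 0) :
    ∃ i, (minimalRegular (-1) N B).val = B i ∧ (interleave (B i)).map (red R) ≠ 0 ∧
      ∀ j, (interleave (B j)).map (red R) ≠ 0 →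
        (interleave (B i)).natDegree ≤ (interleave (B j)).natDegree := by
  classical
  set ρ : Fin 4 → Bool := fun i =>
    (isRegularPoly N (B i).1).val || (isRegularPoly N (B i).2).val with hρ
  have hρ' : ∀ i, ρ i = true ↔ (interleave (B i)).map (red R) ≠ 0 := fun i => by
    rw [map_red_interleave_ne_zero_iff, hρ, Bool.or_eq_true, isRegularPoly_val (hB i).1,
      isRegularPoly_val (hB i).2]
  set τ : Fin 4 → PairTerm := fun i => (findLeadTerm (-1) N (B i)).val with hτ
  have hτ' : ∀ i, ρ i = true → termRank (τ i) = (interleave (B i)).natDegree := fun i hi => by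
    rw [hτ]
    simp only [findLeadTerm_val (hB i).1 (hB i).2]
    refine termRank_leadTerm fun h => ?_
    rw [hρ', h] at hi
    simp at hi
  set o := (List.finRange 4).find? fun i =>
      ρ i && decide (∀ j, ρ j = true → ¬ termLT (-1) (τ j) (τ i)) with ho
  have hval : (minimalRegular (-1) N B).val =
      (match o with | some i => (pure (B i) : Counted _) | none => pure 0).val := rfl
  rcases hcase : o with _ | i
  · exfalso
    obtain ⟨i₀, hi₀⟩ := hreg
    obtain ⟨i, hi, hmin⟩ := Finset.exists_min_image (Finset.univ.filter fun i => ρ i = true)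
      (fun i => (interleave (B i)).natDegree) ⟨i₀, by simpa using (hρ' i₀).2 hi₀⟩
    simp only [Finset.mem_filter, Finset.mem_univ, true_and] at hi hmin
    rw [hcase, eq_comm, List.find?_eq_none] at ho
    refine ho i (List.mem_finRange i) ?_
    rw [Bool.and_eq_true, decide_eq_true_iff]
    refine ⟨hi, fun j hj => ?_⟩
    rw [termLT_iff, hτ' i hi, hτ' j hj, not_lt]
    exact hmin j hj
  · rw [hcase] at ho
    have hi := List.find?_some ho.symm
    rw [Bool.and_eq_true, decide_eq_true_iff] at hi
    refine ⟨i, by rw [hval, hcase]; rfl, (hρ' i).1 hi.1, fun j hj => ?_⟩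
    have := hi.2 j ((hρ' j).2 hj)
    rwa [termLT_iff, hτ' i hi.1, hτ' j ((hρ' j).2 hj), not_lt] at this

variable [IsGR4 R]

theorem natDegree_map_red {p : R[X]} (hp : IsUnit p.leadingCoeff) :
    (p.map (red R)).natDegree = p.natDegree :=
  natDegree_map_of_leadingCoeff_ne_zero _ (IsGR4.isUnit_iff_red_ne_zero.1 hp)

theorem map_red_ne_zero_of_isUnit_leadingCoeff {p : R[X]} (hp : IsUnit p.leadingCoeff) :
    p.map (red R) ≠ 0 := by
  intro h
  refine IsGR4.isUnit_iff_red_ne_zero.1 hp ?_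
  rw [leadingCoeff, ← coeff_map, h, coeff_zero]

/-- Modulo `2`, every small solution is a multiple of an admissible one.  The multiplier `q`
arises from `2 ∈ (a, b)`: writing `2 = a A + b B` and `2 q = a' A + b' B` gives
`2 [a', b'] = 2 q [a, b]`. -/
theorem IsKeySolution.exists_ratio {t : ℕ} {T : R[X]} {p p' : R[X] × R[X]}
    (hp : IsKeySolution t T p) (hp' : p' ∈ solutionModule (1 + T) (t + 1))
    (hd' : (interleave p').natDegree ≤ t + 1) :
    ∃ q : R[X], 2 * q ∈ Ideal.span {p'.1, p'.2} ∧
      (interleave p').map (red R) =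
        expand _ 2 (q.map (red R)) * (interleave p).map (red R) := by
  obtain ⟨hmem, hd, h2, hu⟩ := isKeySolution_iff.1 hp
  obtain ⟨A, B, hAB⟩ := Ideal.mem_span_pair.1 h2
  have hcross := fst_mul_snd_eq hmem hp' hd hd'
  set q₀ := A * p'.1 + B * p'.2 with hq₀
  have h0 : (2 : R[X]) • p' = q₀ • p := by
    refine Prod.ext ?_ ?_
    · simp only [Prod.smul_fst, smul_eq_mul]
      linear_combination -p'.1 * hAB - B * hcross
    · simp only [Prod.smul_snd, smul_eq_mul]
      linear_combination -p'.2 * hAB + A * hcross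
  have hI := congrArg interleave h0
  rw [interleave_smul, interleave_smul, map_ofNat] at hI
  have hI0 := congrArg (Polynomial.map (red R)) hI
  rw [IsGR4.map_red_eq_zero_iff.2 (Dvd.intro _ rfl), Polynomial.map_mul, map_expand] at hI0
  have hq0 : q₀.map (red R) = 0 := by
    rcases mul_eq_zero.1 hI0.symm with h | h
    · rwa [expand_eq_zero two_pos] at h
    · exact absurd h (map_red_ne_zero_of_isUnit_leadingCoeff hu)
  obtain ⟨q, hq⟩ := IsGR4.map_red_eq_zero_iff.1 hq0
  refine ⟨q, ?_, ?_⟩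
  · rw [← hq]
    exact Ideal.mem_span_pair.2 ⟨A, B, rfl⟩
  · rw [← map_expand, ← Polynomial.map_mul, ← sub_eq_zero, ← Polynomial.map_sub,
      ← IsGR4.poly_two_mul_eq_zero_iff]
    rw [hq, map_mul, map_ofNat] at hI
    linear_combination hI

/-- An admissible solution has the least degree among the solutions outside `2R[z]²`. -/
theorem IsKeySolution.natDegree_le {t : ℕ} {T : R[X]} {p p' : R[X] × R[X]}
    (hp : IsKeySolution t T p) (hp' : p' ∈ solutionModule (1 + T) (t + 1))
    (h0 : (interleave p').map (red R) ≠ 0) :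
    (interleave p).natDegree ≤ (interleave p').natDegree := by
  obtain ⟨hmem, hd, h2, hu⟩ := isKeySolution_iff.1 hp
  by_contra! hlt
  obtain ⟨q, -, hq⟩ := hp.exists_ratio hp' (by omega)
  have hq0 : expand _ 2 (q.map (red R)) ≠ 0 := fun h => h0 (by rw [hq, h, zero_mul])
  have := congrArg natDegree hq
  rw [natDegree_mul hq0 (map_red_ne_zero_of_isUnit_leadingCoeff hu), natDegree_map_red hu] at this
  have hle := natDegree_map_le (f := red R) (p := interleave p')
  omega

/-- Conversely, every solution outside `2R[z]²` of that degree is admissible, and agrees modulo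
`2` with the given one up to a constant factor. -/
theorem IsKeySolution.of_natDegree_le {t : ℕ} {T : R[X]} {p p' : R[X] × R[X]}
    (hp : IsKeySolution t T p) (hp' : p' ∈ solutionModule (1 + T) (t + 1))
    (h0 : (interleave p').map (red R) ≠ 0)
    (hle : (interleave p').natDegree ≤ (interleave p).natDegree) :
    IsKeySolution t T p' ∧ ∃ θ : R, IsUnit θ ∧
      (interleave p').map (red R) = C (red R θ) * (interleave p).map (red R) := by
  obtain ⟨hmem, hd, h2, hu⟩ := isKeySolution_iff.1 hp
  obtain ⟨q, hqmem, hq⟩ := hp.exists_ratio hp' (by omega)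
  have hq0 : expand _ 2 (q.map (red R)) ≠ 0 := fun h => h0 (by rw [hq, h, zero_mul])
  have hqd : (q.map (red R)).natDegree = 0 := by
    have := congrArg natDegree hq
    rw [natDegree_mul hq0 (map_red_ne_zero_of_isUnit_leadingCoeff hu), natDegree_map_red hu,
      natDegree_expand] at this
    have hle := natDegree_map_le (f := red R) (p := interleave p')
    omega
  set θ := q.coeff 0 with hθ
  have hqC : q.map (red R) = C (red R θ) := by
    rw [eq_C_of_natDegree_eq_zero hqd, coeff_map]
  rw [hqC, expand_C] at hq
  have hθu : IsUnit θ := by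
    rw [IsGR4.isUnit_iff_red_ne_zero]
    intro h
    rw [hqC, h] at hq0
    simp at hq0
  refine ⟨isKeySolution_iff.2 ⟨hp', hle.trans hd, ?_, ?_⟩, θ, hθu, hq⟩
  · have h2q : 2 * q = 2 * C θ := by
      rw [← sub_eq_zero, ← mul_sub, IsGR4.poly_two_mul_eq_zero_iff, Polynomial.map_sub, hqC,
        map_C, sub_self]
    rw [h2q] at hqmem
    obtain ⟨η, hη⟩ := hθu.exists_right_inv
    have := Ideal.mul_mem_right (C η) _ hqmem
    rwa [mul_assoc, ← C_mul, hη, C_1, mul_one] at this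
  · have hc : red R ((interleave p').coeff (interleave p).natDegree) ≠ 0 := by
      rw [← coeff_map, hq, coeff_C_mul, coeff_map, coeff_natDegree]
      exact mul_ne_zero (IsGR4.isUnit_iff_red_ne_zero.1 hθu) (IsGR4.isUnit_iff_red_ne_zero.1 hu)
    have hne : (interleave p').coeff (interleave p).natDegree ≠ 0 := fun h => hc (by
      rw [h, map_zero])
    have hdeg : (interleave p').natDegree = (interleave p).natDegree :=
      le_antisymm hle (le_natDegree_of_ne_zero hne)
    rw [leadingCoeff, hdeg]
    exact IsGR4.isUnit_iff_red_ne_zero.2 hc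

theorem IsKeySolution.unique_mod_two {t : ℕ} {T : R[X]} {p p' : R[X] × R[X]}
    (hp : IsKeySolution t T p) (hp' : IsKeySolution t T p') :
    ∃ θ : R, IsUnit θ ∧
      (interleave p').map (red R) = C (red R θ) * (interleave p).map (red R) :=
  (hp.of_natDegree_le hp'.mem
    (map_red_ne_zero_of_isUnit_leadingCoeff (isKeySolution_iff.1 hp').2.2.2)
    (hp'.natDegree_le hp.mem
      (map_red_ne_zero_of_isUnit_leadingCoeff (isKeySolution_iff.1 hp).2.2.2))).2

/-- If an admissible solution exists, the strong Gröbner property provides a basis element with unit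
leading coefficient of at most its degree, so the minimal regular element is admissible. -/
theorem isKeySolver_approxSolve (t : ℕ) :
    IsKeySolver t (approxSolve t : R[X] → Counted (R[X] × R[X])) := by
  rintro T ⟨p, hp⟩
  have hU : T - C (T.coeff 0) + C (1 + T.coeff 0) = 1 + T := by
    rw [C_add, C_1]; ring
  have hval : (approxSolve t T).val =
      (minimalRegular (-1) (t + 2) (approxBasis (-1) (1 + T) (t + 1)).val).val := by
    rw [← hU]; rfl
  rw [hval]
  have hB := approxInvariant_approxBasis (1 + T) (t + 1)
  set B := (approxBasis (-1) (1 + T) (t + 1)).val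
  obtain ⟨hmem, -, -, hu⟩ := isKeySolution_iff.1 hp
  have hp0 : p ≠ 0 := by
    rintro rfl
    simp at hu
  obtain ⟨i, e, c, hc, hde, hlc⟩ := hB.strong p hmem hp0
  have hi : (interleave (B i)).map (red R) ≠ 0 :=
    map_red_ne_zero_of_isUnit_leadingCoeff (isUnit_of_mul_isUnit_right (hlc ▸ hu))
  obtain ⟨j, hj, hjreg, hjmin⟩ := minimalRegular_spec (N := t + 2) (fun i =>
    ⟨Nat.lt_succ_of_le (hB.natDegree_le i).1, Nat.lt_succ_of_le (hB.natDegree_le i).2⟩) ⟨i, hi⟩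
  rw [hj]
  have := hjmin i hi
  exact (hp.of_natDegree_le (hB.mem j) hjreg (by omega)).1

end

section

/-! ### Error locator polynomials -/

variable {R : Type} [CommRing R]

/-- The pair `[E, F]` with `σ = E(x²) + x F(x²)`. -/
def deinterleave (σ : R[X]) : R[X] × R[X] := (contract 2 σ, contract 2 (divX σ))

theorem interleave_deinterleave (σ : R[X]) : interleave (deinterleave σ) = σ := by
  ext k
  rcases Nat.even_or_odd' k with ⟨i, rfl | rfl⟩
  · rw [coeff_interleave_even, deinterleave, coeff_contract two_ne_zero, mul_comm]
  · rw [coeff_interleave_odd, deinterleave, coeff_contract two_ne_zero, coeff_divX, mul_comm]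

/-- The polynomial `∏ (1 - x z)` over a multiset of error locations `x`. -/
def errorLocator (L : Multiset R) : R[X] := (L.map fun x => 1 - C x * X).prod

@[simp] theorem errorLocator_zero : errorLocator (0 : Multiset R) = 1 := by simp [errorLocator]

theorem errorLocator_cons (x : R) (L : Multiset R) :
    errorLocator (x ::ₘ L) = (1 - C x * X) * errorLocator L := by
  simp [errorLocator]

/-- The pair `[E, F]` with `σ = E(z²) + z F(z²)` for the error locator polynomial `σ`. -/
def locatorParts (L : Multiset R) : R[X] × R[X] := deinterleave (errorLocator L)

theorem interleave_locatorParts (L : Multiset R) :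
    interleave (locatorParts L) = errorLocator L := interleave_deinterleave _

theorem locatorParts_zero : locatorParts (0 : Multiset R) = (1, 0) := by
  apply interleave_injective
  rw [interleave_locatorParts]
  simp [interleave]

theorem locatorParts_cons (x : R) (L : Multiset R) :
    locatorParts (x ::ₘ L) = ((locatorParts L).1 - C x * X * (locatorParts L).2,
      (locatorParts L).2 - C x * (locatorParts L).1) := by
  apply interleave_injective
  rw [interleave_locatorParts, errorLocator_cons, ← interleave_locatorParts]
  simp only [interleave, map_sub, map_mul, expand_C, expand_X]
  ring

theorem coeff_zero_locatorParts_fst (L : Multiset R) : (locatorParts L).1.coeff 0 = 1 := by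
  induction L using Multiset.induction with
  | empty => simp [locatorParts_zero]
  | cons x L ih => simp [locatorParts_cons, ih]

/-- The pair `[E + z F, E]`.  It solves the key equation because `1 + T` is the inverse of
`1 + z F / E`. -/
def keyPair (L : Multiset R) : R[X] × R[X] :=
  ((locatorParts L).1 + X * (locatorParts L).2, (locatorParts L).1)

theorem interleave_keyPair (L : Multiset R) :
    interleave (keyPair L) = expand R 2 (locatorParts L).1 + X * errorLocator L := by
  rw [← interleave_locatorParts]
  simp only [interleave, keyPair, map_add, map_mul, expand_X]
  ring

theorem eval_errorLocator (L : Multiset R) (y : R) :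
    (errorLocator L).eval y = (L.map fun x => 1 - x * y).prod := by
  rw [errorLocator, eval_multiset_prod, Multiset.map_map]
  simp

/-- In a prime ideal over `2` that contains the even and the odd part of the error locator
polynomial, some factor `1 - x z` must lie; a simple factor is then impossible, and the
membership that is assumed for a double factor excludes it as well. -/
theorem not_mem_prime_locatorParts (m : Ideal R[X]) [hm : m.IsPrime] (h2 : (2 : R[X]) ∈ m)
    (L : Multiset R) (hE : expand R 2 (locatorParts L).1 ∈ m)
    (hF : X * expand R 2 (locatorParts L).2 ∈ m) (hunit : ∀ x ∈ L, IsUnit x)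
    (hsep : ∀ x ∈ L, ∃ L₁ : Multiset R, (∀ y ∈ L₁, IsUnit (y - x)) ∧ (L = x ::ₘ L₁ ∨
      C x * X * ((X * expand R 2 (locatorParts L₁).2) ^ 2 -
        (expand R 2 (locatorParts L₁).1) ^ 2) ∈ m)) : False := by
  have hX : X ∉ m := by
    intro hX
    refine hm.one_notMem ?_
    have h := X_mul_divX_add (locatorParts L).1
    rw [coeff_zero_locatorParts_fst, C_1] at h
    have h' := congrArg (expand R 2) h
    rw [map_add, map_mul, expand_X, map_one] at h'
    have : (1 : R[X]) = expand R 2 (locatorParts L).1 -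
        X * (X * expand R 2 (divX (locatorParts L).1)) := by linear_combination h'
    rw [this]
    exact sub_mem hE (m.mul_mem_right _ hX)
  have hC : ∀ {c : R} {p : R[X]}, IsUnit c → C c * p ∈ m → p ∈ m := by
    intro c p hc h
    refine (hm.mem_or_mem h).resolve_left fun h' => hm.ne_top ?_
    exact Ideal.eq_top_of_isUnit_mem _ h' (hc.map C)
  have hfactor : ∀ L' : Multiset R, errorLocator L' ∈ m → ∃ x ∈ L', 1 - C x * X ∈ m := by
    intro L'
    induction L' using Multiset.induction with
    | empty => intro h; exact absurd (by simpa using h) hm.one_notMem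
    | cons x L' ih =>
      rw [errorLocator_cons]
      intro h
      rcases hm.mem_or_mem h with h | h
      · exact ⟨x, Multiset.mem_cons_self _ _, h⟩
      · obtain ⟨y, hy, hy'⟩ := ih h
        exact ⟨y, Multiset.mem_cons_of_mem hy, hy'⟩
  obtain ⟨x, hxL, hx⟩ := hfactor L (by
    rw [← interleave_locatorParts]; exact add_mem hE hF)
  obtain ⟨L₁, hL₁, hcase⟩ := hsep x hxL
  have hnot : errorLocator L₁ ∉ m := by
    intro h
    obtain ⟨y, hy, hy'⟩ := hfactor L₁ h
    refine hX (hC (hL₁ y hy) ?_)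
    rw [C_sub, show (C y - C x) * X = (1 - C x * X) - (1 - C y * X) by ring]
    exact sub_mem hx hy'
  refine hnot ?_
  rw [← interleave_locatorParts]
  rcases hcase with hcase | hcase
  · rw [hcase, locatorParts_cons] at hE
    simp only [map_sub, map_mul, expand_C, expand_X] at hE
    have : interleave (locatorParts L₁) =
        expand R 2 (locatorParts L₁).1 - C x * X ^ 2 * expand R 2 (locatorParts L₁).2 -
        (1 - C x * X) * (X * expand R 2 (locatorParts L₁).2) +
        2 * (X * expand R 2 (locatorParts L₁).2) := by rw [interleave]; ring
    rw [this]
    exact add_mem (sub_mem hE (m.mul_mem_right _ hx)) (m.mul_mem_right _ h2)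
  · rw [mul_assoc] at hcase
    have h1 := (hm.mem_or_mem (hC (hunit x hxL) hcase)).resolve_left hX
    rw [sq_sub_sq] at h1
    rcases hm.mem_or_mem h1 with h | h
    · rwa [interleave, add_comm]
    · have : interleave (locatorParts L₁) = (X * expand R 2 (locatorParts L₁).2 -
        expand R 2 (locatorParts L₁).1) + 2 * expand R 2 (locatorParts L₁).1 := by
        rw [interleave]; ring
      rw [this]
      exact add_mem h (m.mul_mem_right _ h2)

/-- Constants in the extension of an ideal along `z ↦ z²` are already in the ideal. -/
theorem C_mem_span_of_expand {a b : R[X]} {r : R}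
    (h : C r ∈ Ideal.span {expand R 2 a, expand R 2 b}) : C r ∈ Ideal.span {a, b} := by
  obtain ⟨A, B, hAB⟩ := Ideal.mem_span_pair.1 h
  refine Ideal.mem_span_pair.2 ⟨contract 2 A, contract 2 B, ?_⟩
  rw [← contract_mul_expand two_ne_zero, ← contract_mul_expand two_ne_zero,
    ← contract_add two_ne_zero, hAB, contract_C]

theorem expand_keyPair_fst_mem {L : Multiset R} {I : Ideal R[X]}
    (hI : I = Ideal.span {expand R 2 (keyPair L).1, expand R 2 (keyPair L).2}) :
    expand R 2 (locatorParts L).1 ∈ I ∧ X * (X * expand R 2 (locatorParts L).2) ∈ I := by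
  have h1 : expand R 2 (keyPair L).1 ∈ I := by rw [hI]; exact Ideal.subset_span (by simp)
  have h2 : expand R 2 (keyPair L).2 ∈ I := by rw [hI]; exact Ideal.subset_span (by simp)
  refine ⟨h2, ?_⟩
  have := sub_mem h1 h2
  simp only [keyPair, map_add, map_mul, expand_X] at this
  convert this using 1; ring

theorem X_mul_mem_of_X_mul_X_mul_mem {A : Type} [CommRing A] {m : Ideal A[X]} [hm : m.IsPrime]
    {p : A[X]} (h : X * (X * p) ∈ m) : X * p ∈ m :=
  (hm.mem_or_mem h).elim (fun h => m.mul_mem_right _ h) id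

variable [IsGR4 R]

theorem two_mem_of_isPrime (m : Ideal R[X]) [hm : m.IsPrime] : (2 : R[X]) ∈ m := by
  refine (or_self_iff).1 (hm.mem_or_mem ?_)
  have : (2 : R[X]) * 2 = C 4 := by rw [show (C 4 : R[X]) = 4 from rfl]; norm_num
  rw [this, IsGR4.four_eq_zero, C_0]
  exact m.zero_mem

/-- If the error locations are separated modulo `2` up to repeating some of them once, then `2`
lies in the ideal of the key equation's solution `[a, b]`. -/
theorem two_mem_span_keyPair (L : Multiset R) (hunit : ∀ x ∈ L, IsUnit x)
    (hsep : ∀ x ∈ L, ∃ L₁ : Multiset R, (∀ y ∈ L₁, IsUnit (y - x)) ∧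
      (L = x ::ₘ L₁ ∨ L = x ::ₘ x ::ₘ L₁)) :
    (2 : R[X]) ∈ Ideal.span {(keyPair L).1, (keyPair L).2} := by
  refine C_mem_span_of_expand (r := 2) ?_
  set I := Ideal.span {expand R 2 (keyPair L).1, expand R 2 (keyPair L).2} with hI
  -- the ideal quotient `(I : 2)`
  set J : Ideal R[X] := Submodule.comap (LinearMap.mulLeft R[X] (2 : R[X])) I with hJ
  have hJmem : ∀ p, p ∈ J ↔ 2 * p ∈ I := fun p => Iff.rfl
  suffices hJtop : J = ⊤ by
    have := (hJmem 1).1 (by rw [hJtop]; trivial)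
    rwa [mul_one] at this
  by_contra hne
  obtain ⟨m, hmax, hle⟩ := Ideal.exists_le_maximal J hne
  have hm : m.IsPrime := hmax.isPrime
  obtain ⟨hE, hF⟩ := expand_keyPair_fst_mem hI
  have hIm : I ≤ m := fun p hp => hle ((hJmem p).2 (I.mul_mem_left _ hp))
  refine not_mem_prime_locatorParts m (two_mem_of_isPrime m) L (hIm hE)
    (X_mul_mem_of_X_mul_X_mul_mem (hIm hF)) hunit fun x hx => ?_
  obtain ⟨L₁, hL₁, hcase | hcase⟩ := hsep x hx
  · exact ⟨L₁, hL₁, .inl hcase⟩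
  refine ⟨L₁, hL₁, .inr ?_⟩
  refine (hm.mem_or_mem (hle ((hJmem (X * _)).2 ?_))).elim
    (fun h => m.mul_mem_right _ (m.mul_mem_left _ h)) id
  rw [hcase, locatorParts_cons, locatorParts_cons] at hE hF
  simp only [map_sub, map_mul, expand_C, expand_X] at hE hF
  -- a 2×2 determinant eliminates the terms that are not multiples of `2`
  convert sub_mem (I.mul_mem_left (expand R 2 (locatorParts L₁).1) hF)
    (I.mul_mem_left (X ^ 2 * expand R 2 (locatorParts L₁).2) hE) using 1
  ring

/-- If the error locations are distinct modulo `2`, then `[a, b]` is unimodular. -/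
theorem one_mem_span_keyPair (L : Multiset R) (hunit : ∀ x ∈ L, IsUnit x)
    (hsep : ∀ x ∈ L, ∃ L₁ : Multiset R, (∀ y ∈ L₁, IsUnit (y - x)) ∧ L = x ::ₘ L₁) :
    (1 : R[X]) ∈ Ideal.span {(keyPair L).1, (keyPair L).2} := by
  rw [← C_1]
  refine C_mem_span_of_expand ?_
  rw [C_1, ← Ideal.eq_top_iff_one]
  by_contra hne
  obtain ⟨m, hmax, hle⟩ := Ideal.exists_le_maximal _ hne
  have hm : m.IsPrime := hmax.isPrime
  obtain ⟨hE, hF⟩ := expand_keyPair_fst_mem (L := L) rfl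
  refine not_mem_prime_locatorParts m (two_mem_of_isPrime m) L (hle hE)
    (X_mul_mem_of_X_mul_X_mul_mem (hle hF)) hunit fun x hx => ?_
  obtain ⟨L₁, hL₁, hcase⟩ := hsep x hx
  exact ⟨L₁, hL₁, .inl hcase⟩

theorem natDegree_errorLocator (L : Multiset R) (hunit : ∀ x ∈ L, IsUnit x) :
    (errorLocator L).natDegree = Multiset.card L ∧ IsUnit (errorLocator L).leadingCoeff := by
  induction L using Multiset.induction with
  | empty => simp
  | cons x L ih =>
    obtain ⟨h1, h2⟩ := ih fun y hy => hunit y (Multiset.mem_cons_of_mem hy)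
    have hx := hunit x (Multiset.mem_cons_self _ _)
    have hlin : (1 - C x * X : R[X]) = C (-x) * X + C 1 := by rw [C_neg, C_1]; ring
    have hne : -x ≠ 0 := neg_ne_zero.2 hx.ne_zero
    have hu : IsUnit ((1 - C x * X : R[X]).leadingCoeff * (errorLocator L).leadingCoeff) := by
      rw [hlin, leadingCoeff_linear hne]; exact hx.neg.mul h2
    rw [errorLocator_cons, natDegree_mul' hu.ne_zero, leadingCoeff_mul' hu.ne_zero, h1, hlin,
      natDegree_linear hne, Multiset.card_cons, add_comm, ← hlin]
    exact ⟨rfl, hu⟩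

theorem natDegree_keyPair (L : Multiset R) (hunit : ∀ x ∈ L, IsUnit x) :
    (interleave (keyPair L)).natDegree = Multiset.card L + 1 ∧
      IsUnit (interleave (keyPair L)).leadingCoeff := by
  obtain ⟨h1, h2⟩ := natDegree_errorLocator L hunit
  have hX : (X * errorLocator L).natDegree = Multiset.card L + 1 := by
    rw [natDegree_X_mul, h1]; exact leadingCoeff_ne_zero.1 h2.ne_zero
  have hlt : (expand R 2 (locatorParts L).1).natDegree < (X * errorLocator L).natDegree := by
    have := natDegree_fst_le (locatorParts L)
    rw [interleave_locatorParts] at this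
    rw [natDegree_expand]
    omega
  rw [interleave_keyPair, natDegree_add_eq_right_of_natDegree_lt hlt,
    leadingCoeff_add_of_degree_lt (degree_lt_degree hlt)]
  refine ⟨hX, ?_⟩
  rwa [mul_comm, leadingCoeff_mul_X]

end

section

/-! ### The key equation of the error locator polynomial -/

variable {R : Type} [CommRing R]

/-- The power sum of the error locations with odd exponent `2 i + 1`. -/
def oddPowerSum (L : Multiset R) (i : ℕ) : R := (L.map fun x => x ^ (2 * i + 1)).sum

/-- The generating function of the odd powers of `x` is `x / (1 - x² z)`. -/
theorem mk_odd_pow_mul (x : R) :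
    (1 - PowerSeries.C (x ^ 2) * PowerSeries.X) *
      PowerSeries.mk (fun i => x ^ (2 * i + 1)) = PowerSeries.C x := by
  ext i
  rw [sub_mul, one_mul, mul_assoc, map_sub, PowerSeries.coeff_C_mul, PowerSeries.coeff_mk,
    PowerSeries.coeff_C]
  rcases i with _ | i
  · simp
  · rw [PowerSeries.coeff_succ_X_mul, PowerSeries.coeff_mk, if_neg (by omega)]
    ring

/-- Newton's identities for the odd power sums, in terms of the even and odd parts of the error
locator polynomial.  They hold without division by `2`. -/
theorem newton_odd (L : Multiset R) :
    (((locatorParts L).1 * (locatorParts L).2 + 2 * X *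
        (derivative (locatorParts L).2 * (locatorParts L).1 -
          (locatorParts L).2 * derivative (locatorParts L).1) : R[X]) : PowerSeries R) =
      -PowerSeries.mk (oddPowerSum L) *
        (((locatorParts L).1 ^ 2 - X * (locatorParts L).2 ^ 2 : R[X]) : PowerSeries R) := by
  induction L using Multiset.induction with
  | empty =>
    have : PowerSeries.mk (oddPowerSum (0 : Multiset R)) = 0 := by
      ext i; simp [oddPowerSum]
    simp [locatorParts_zero, this]
  | cons x L ih =>
    have hS : PowerSeries.mk (oddPowerSum (x ::ₘ L)) =
        PowerSeries.mk (fun i => x ^ (2 * i + 1)) + PowerSeries.mk (oddPowerSum L) := by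
      ext i; simp [oddPowerSum]
    rw [hS, locatorParts_cons]
    set E := (locatorParts L).1
    set F := (locatorParts L).2
    have hW : (E - C x * X * F) * (F - C x * E) + 2 * X *
        (derivative (F - C x * E) * (E - C x * X * F) -
          (F - C x * E) * derivative (E - C x * X * F)) =
        (1 - C (x ^ 2) * X) * (E * F + 2 * X * (derivative F * E - F * derivative E)) -
          C x * (E ^ 2 - X * F ^ 2) := by
      simp only [derivative_sub, derivative_mul, derivative_C, derivative_X, C_pow]
      ring
    have hN : (E - C x * X * F) ^ 2 - X * (F - C x * E) ^ 2 =
        (1 - C (x ^ 2) * X) * (E ^ 2 - X * F ^ 2) := by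
      rw [C_pow]; ring
    have hx := mk_odd_pow_mul x
    simp only [hW, hN]
    set W := E * F + 2 * X * (derivative F * E - F * derivative E)
    set N := E ^ 2 - X * F ^ 2
    simp only [Polynomial.coe_sub, Polynomial.coe_mul, Polynomial.coe_one, Polynomial.coe_C,
      Polynomial.coe_X]
    linear_combination (1 - PowerSeries.C (x ^ 2) * PowerSeries.X) * ih + (N : PowerSeries R) * hx

/-- The odd series `u` of the decoder, as a power series in `z²`: the quotient of the odd and the
even part of the error locator polynomial. -/
def oddSeries (L : Multiset R) : PowerSeries R :=
  ((locatorParts L).2 : PowerSeries R) * PowerSeries.invOfUnit (locatorParts L).1 1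

theorem constantCoeff_locatorParts_fst (L : Multiset R) :
    PowerSeries.constantCoeff ((locatorParts L).1 : PowerSeries R) = ((1 : Rˣ) : R) := by
  rw [← PowerSeries.coeff_zero_eq_constantCoeff_apply, Polynomial.coeff_coe,
    coeff_zero_locatorParts_fst, Units.val_one]

theorem mul_oddSeries (L : Multiset R) :
    ((locatorParts L).1 : PowerSeries R) * oddSeries L = (locatorParts L).2 := by
  have := PowerSeries.mul_invOfUnit ((locatorParts L).1 : PowerSeries R) 1
    (constantCoeff_locatorParts_fst L)
  rw [oddSeries]
  linear_combination ((locatorParts L).2 : PowerSeries R) * this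

/-- The differential equation `s_o (u² - 1) = z u'`, in the variable `z²`. -/
theorem oddSeries_differential (L : Multiset R) :
    oddSeries L + 2 * PowerSeries.X * PowerSeries.derivative R (oddSeries L) =
      PowerSeries.mk (oddPowerSum L) * (PowerSeries.X * oddSeries L ^ 2 - 1) := by
  have hN := newton_odd L
  have hU := mul_oddSeries L
  have hinv := PowerSeries.mul_invOfUnit ((locatorParts L).1 : PowerSeries R) 1
    (constantCoeff_locatorParts_fst L)
  set E := (locatorParts L).1
  set F := (locatorParts L).2
  set u := oddSeries L
  have hd : (derivative F : PowerSeries R) =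
      E * PowerSeries.derivative R u + u * (derivative E : PowerSeries R) := by
    have := congrArg (PowerSeries.derivative R) hU
    rw [Derivation.leibniz, PowerSeries.derivative_coe, PowerSeries.derivative_coe] at this
    exact this.symm
  simp only [Polynomial.coe_add, Polynomial.coe_sub, Polynomial.coe_mul, Polynomial.coe_X,
    Polynomial.coe_pow, hd, ← hU] at hN
  have h2 : ((2 : R[X]) : PowerSeries R) = 2 := by
    rw [show (2 : R[X]) = C 2 from rfl, Polynomial.coe_C]; exact map_ofNat _ 2
  rw [h2] at hN
  set V := PowerSeries.invOfUnit (E : PowerSeries R) 1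
  set e : PowerSeries R := (E : PowerSeries R)
  set du := PowerSeries.derivative R u
  set S := PowerSeries.mk (oddPowerSum L)
  have key : e ^ 2 * (u + 2 * PowerSeries.X * du - S * (PowerSeries.X * u ^ 2 - 1)) = 0 := by
    linear_combination hN
  have hone : V ^ 2 * e ^ 2 = 1 := by
    rw [← mul_pow, mul_comm V, hinv, one_pow]
  linear_combination V ^ 2 * key - (u + 2 * PowerSeries.X * du -
    S * (PowerSeries.X * u ^ 2 - 1)) * hone

theorem powerSeries_coeff_X_mul (i : ℕ) (f : PowerSeries R) :
    PowerSeries.coeff i (PowerSeries.X * f) =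
      if i = 0 then 0 else PowerSeries.coeff (i - 1) f := by
  rcases i with _ | i
  · simp
  · rw [PowerSeries.coeff_succ_X_mul, if_neg (by omega), Nat.add_sub_cancel]

theorem coeff_oddSeries (L : Multiset R) (i : ℕ) :
    ((2 * i + 1 : ℕ) : R) * PowerSeries.coeff i (oddSeries L) =
      ∑ l ∈ Finset.range i, oddPowerSum L l *
        PowerSeries.coeff (i - l - 1) (oddSeries L ^ 2) - oddPowerSum L i := by
  have h := congrArg (PowerSeries.coeff i) (oddSeries_differential L)
  have hL : PowerSeries.coeff i
      (oddSeries L + 2 * PowerSeries.X * PowerSeries.derivative R (oddSeries L)) =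
      ((2 * i + 1 : ℕ) : R) * PowerSeries.coeff i (oddSeries L) := by
    rw [map_add, mul_assoc, show (2 : PowerSeries R) = PowerSeries.C 2 from
      (map_ofNat (PowerSeries.C (R := R)) 2).symm, PowerSeries.coeff_C_mul, powerSeries_coeff_X_mul]
    rcases i with _ | i
    · simp
    · rw [if_neg (by omega), Nat.add_sub_cancel, PowerSeries.coeff_derivative]
      push_cast; ring
  rw [← hL, h, mul_sub, mul_one, map_sub, PowerSeries.coeff_mk]
  congr 1
  rw [PowerSeries.coeff_mul, Finset.Nat.sum_antidiagonal_eq_sum_range_succ_mk,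
    Finset.sum_range_succ]
  simp only [PowerSeries.coeff_mk, powerSeries_coeff_X_mul, Nat.sub_self, if_true, mul_zero,
    add_zero]
  refine Finset.sum_congr rfl fun l hl => ?_
  rw [if_neg (by have := Finset.mem_range.1 hl; omega)]

theorem isUnit_odd_natCast [IsGR4 R] (i : ℕ) : IsUnit ((2 * i + 1 : ℕ) : R) := by
  push_cast
  rw [add_comm]
  exact IsGR4.isUnit_one_add_two_mul IsGR4.four_eq_zero _

theorem uCoeffs_val [IsGR4 R] (L : Multiset R) (t : ℕ) (s : ℕ → R)
    (hs : ∀ i < t, s i = oddPowerSum L i) :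
    ∀ i < t, (uCoeffs t s).val i = PowerSeries.coeff i (oddSeries L) := by
  set step : ℕ → (ℕ → R) × (ℕ → R) → Counted ((ℕ → R) × (ℕ → R)) := fun i r => do
    let y ← Counted.sum i fun l => mul (s l) (r.2 (i - l - 1))
    let y' ← sub y (s i)
    let x ← div y' ((2 * i + 1 : ℕ) : R)
    let u := Function.update r.1 i x
    let q ← Counted.sum (i + 1) fun a => mul (u a) (u (i - a))
    pure (u, Function.update r.2 i q) with hstep
  have key : ∀ k ≤ t, ∀ i < k,
      (loop step (fun _ => 0, fun _ => 0) k).val.1 i = PowerSeries.coeff i (oddSeries L) ∧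
      (loop step (fun _ => 0, fun _ => 0) k).val.2 i =
        PowerSeries.coeff i (oddSeries L ^ 2) := by
    intro k
    induction k with
    | zero => intro _ i hi; exact absurd hi (Nat.not_lt_zero i)
    | succ k ih =>
      intro hk
      rw [loop_val_succ]
      set r := (loop step (fun _ => 0, fun _ => 0) k).val
      have ih' := ih (by omega)
      set y := (Counted.sum k fun l => mul (s l) (r.2 (k - l - 1))).val - s k with hy
      set x := (div y ((2 * k + 1 : ℕ) : R)).val with hx
      set u := Function.update r.1 k x with hu
      set q := (Counted.sum (k + 1) fun a => mul (u a) (u (k - a))).val with hq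
      change ∀ i < k + 1, u i = _ ∧ Function.update r.2 k q i = _
      have hyval : y = ((2 * k + 1 : ℕ) : R) * PowerSeries.coeff k (oddSeries L) := by
        rw [hy, coeff_oddSeries, sum_val, hs k (by omega)]
        congr 1
        refine Finset.sum_congr rfl fun l hl => ?_
        have := Finset.mem_range.1 hl
        change s l * r.2 (k - l - 1) = _
        rw [hs l (by omega), (ih' (k - l - 1) (by omega)).2]
      have hxval : x = PowerSeries.coeff k (oddSeries L) := by
        refine (isUnit_odd_natCast k).mul_left_cancel ?_
        rw [← hyval]
        exact (div_val (isUnit_odd_natCast k).dvd).symm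
      have huval : ∀ i < k + 1, u i = PowerSeries.coeff i (oddSeries L) := by
        intro i hi
        rcases eq_or_ne i k with rfl | hik
        · rw [hu, Function.update_self, hxval]
        · rw [hu, Function.update_of_ne hik, (ih' i (by omega)).1]
      intro i hi
      refine ⟨huval i hi, ?_⟩
      rcases eq_or_ne i k with rfl | hik
      · rw [Function.update_self, hq, sum_val, sq, PowerSeries.coeff_mul,
          Finset.Nat.sum_antidiagonal_eq_sum_range_succ_mk]
        refine Finset.sum_congr rfl fun a ha => ?_
        have := Finset.mem_range.1 ha
        change u a * u (i - a) = _
        rw [huval a (by omega), huval (i - a) (by omega)]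
      · rw [Function.update_of_ne hik, (ih' i (by omega)).2]
  intro i hi
  exact (key t le_rfl i hi).1

/-- The series `1 + T = (1 + z u(z))⁻¹` in the variable `z²`. -/
def keySeries (L : Multiset R) : PowerSeries R :=
  PowerSeries.invOfUnit (1 + PowerSeries.X * oddSeries L) 1

theorem mul_keySeries (L : Multiset R) :
    (1 + PowerSeries.X * oddSeries L) * keySeries L = 1 :=
  PowerSeries.mul_invOfUnit _ 1 (by simp)

theorem coeff_zero_keySeries (L : Multiset R) : PowerSeries.coeff 0 (keySeries L) = 1 := by
  simp [keySeries]

theorem coeff_succ_keySeries (L : Multiset R) (i : ℕ) :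
    PowerSeries.coeff (i + 1) (keySeries L) = 0 - (PowerSeries.coeff i (oddSeries L) +
      ∑ j ∈ Finset.range i, PowerSeries.coeff j (oddSeries L) *
        PowerSeries.coeff (i - j) (keySeries L)) := by
  have h := congrArg (PowerSeries.coeff (i + 1)) (mul_keySeries L)
  rw [add_mul, one_mul, map_add, mul_assoc, PowerSeries.coeff_succ_X_mul, PowerSeries.coeff_mul,
    Finset.Nat.sum_antidiagonal_eq_sum_range_succ_mk, Finset.sum_range_succ, PowerSeries.coeff_one,
    if_neg (by omega), Nat.sub_self, coeff_zero_keySeries, mul_one] at h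
  linear_combination h

theorem tPoly_coeff (L : Multiset R) (t : ℕ) (u : ℕ → R)
    (hu : ∀ i < t, u i = PowerSeries.coeff i (oddSeries L)) :
    ∀ i ≤ t, (1 + (tPoly t u).val).coeff i = PowerSeries.coeff i (keySeries L) := by
  set step : ℕ → (ℕ → R) → Counted (ℕ → R) := fun i T => do
    let y ← Counted.sum i fun j => mul (u j) (T (i - j))
    let y' ← add (u i) y
    let x ← sub 0 y'
    pure (Function.update T (i + 1) x) with hstep
  have key : ∀ k ≤ t, (loop step (fun _ => 0) k).val 0 = 0 ∧ ∀ i, 0 < i → i ≤ k →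
      (loop step (fun _ => 0) k).val i = PowerSeries.coeff i (keySeries L) := by
    intro k
    induction k with
    | zero => exact fun _ => ⟨rfl, fun i h h' => by omega⟩
    | succ k ih =>
      intro hk
      rw [loop_val_succ]
      obtain ⟨ih0, ih⟩ := ih (by omega)
      set T := (loop step (fun _ => 0) k).val
      change Function.update T (k + 1)
          (0 - (u k + (Counted.sum k fun j => mul (u j) (T (k - j))).val)) 0 = 0 ∧
        ∀ i, 0 < i → i ≤ k + 1 → Function.update T (k + 1)
          (0 - (u k + (Counted.sum k fun j => mul (u j) (T (k - j))).val)) i = _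
      refine ⟨by rw [Function.update_of_ne (by omega), ih0], fun i h0 hi => ?_⟩
      rcases eq_or_ne i (k + 1) with rfl | hik
      · rw [Function.update_self, coeff_succ_keySeries, sum_val, hu k (by omega)]
        congr 2
        refine Finset.sum_congr rfl fun j hj => ?_
        have := Finset.mem_range.1 hj
        change u j * T (k - j) = _
        rw [hu j (by omega), ih (k - j) (by omega) (by omega)]
      · rw [Function.update_of_ne hik, ih i h0 (by omega)]
  obtain ⟨h0, hpos⟩ := key t le_rfl
  intro i hi
  have hT : (tPoly t u).val.coeff i = (loop step (fun _ => 0) t).val i := by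
    change (∑ i ∈ Finset.range (t + 1), monomial i ((loop step (fun _ => 0) t).val i)).coeff i = _
    simp only [finsetSum_coeff, coeff_monomial, Finset.sum_ite_eq', Finset.mem_range]
    rw [if_pos (by omega)]
  rw [coeff_add, hT, coeff_one]
  rcases Nat.eq_zero_or_pos i with rfl | hi0
  · rw [h0, if_pos rfl, add_zero, coeff_zero_keySeries]
  · rw [hpos i hi0 hi, if_neg (by omega), zero_add]

/-- The pair built from the true error locator polynomial solves the key equation whose right-hand
side is computed from the syndromes. -/
theorem keyPair_mem_solutionModule (L : Multiset R) (t : ℕ) (T : R[X])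
    (hT : ∀ i ≤ t, (1 + T).coeff i = PowerSeries.coeff i (keySeries L)) :
    keyPair L ∈ solutionModule (1 + T) (t + 1) := by
  have hdvd : PowerSeries.X ^ (t + 1) ∣ (((1 + T : R[X]) : PowerSeries R) - keySeries L) := by
    rw [PowerSeries.X_pow_dvd_iff]
    intro i hi
    rw [map_sub, Polynomial.coeff_coe, hT i (by omega), sub_self]
  have hmul : ((keyPair L).1 : PowerSeries R) * keySeries L = (keyPair L).2 := by
    simp only [keyPair, Polynomial.coe_add, Polynomial.coe_mul, Polynomial.coe_X]
    linear_combination ((locatorParts L).1 : PowerSeries R) * mul_keySeries L -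
      PowerSeries.X * keySeries L * mul_oddSeries L
  have h := hdvd.mul_left ((keyPair L).1 : PowerSeries R)
  rw [mul_sub, hmul, ← Polynomial.coe_mul, ← Polynomial.coe_sub, PowerSeries.X_pow_dvd_iff] at h
  rw [mem_solutionModule, X_pow_dvd_iff]
  intro i hi
  rw [← Polynomial.coeff_coe]
  exact h i hi

end

section

/-! ### Error vectors and their locations -/

variable {R : Type} [CommRing R]

/-- The error locations at the position with location `x`, for the error value `a`: a double error
counts as `x` twice, and an error `-1` as `-x`.  (Counting a double error as `-x` twice would give
the same factor of the error locator polynomial, as `4 = 0`.) -/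
def locationsAt (x : R) (a : ZMod 4) : Multiset R :=
  if a = 1 then {x} else if a = 2 then {x, x} else if a = 3 then {-x} else 0

theorem zmod4_cases (a : ZMod 4) : a = 0 ∨ a = 1 ∨ a = 2 ∨ a = 3 := by
  revert a; decide

theorem locationsAt_zero (x : R) : locationsAt x 0 = 0 := rfl
theorem locationsAt_one (x : R) : locationsAt x 1 = {x} := rfl
theorem locationsAt_two (x : R) : locationsAt x 2 = {x, x} := rfl
theorem locationsAt_three (x : R) : locationsAt x 3 = {-x} := rfl

theorem card_locationsAt (x : R) (a : ZMod 4) :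
    Multiset.card (locationsAt x a) = leeWeight a := by
  rcases zmod4_cases a with rfl | rfl | rfl | rfl <;> rfl

theorem eq_or_eq_neg_of_mem_locationsAt {x y : R} {a : ZMod 4} (h : y ∈ locationsAt x a) :
    y = x ∨ y = -x := by
  rcases zmod4_cases a with rfl | rfl | rfl | rfl
  · simp [locationsAt_zero] at h
  · simp [locationsAt_one] at h; exact .inl h
  · simp [locationsAt_two] at h; exact .inl h
  · simp [locationsAt_three] at h; exact .inr h

/-- The error locations of an error vector, with multiplicities. -/
def errorLocations {n : ℕ} (α : R) (e : Fin n → ZMod 4) : Multiset R :=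
  ∑ j : Fin n, locationsAt (α ^ (j : ℕ)) (e j)

theorem card_errorLocations {n : ℕ} (α : R) (e : Fin n → ZMod 4) :
    Multiset.card (errorLocations α e) = ∑ j, leeWeight (e j) := by
  rw [errorLocations, Multiset.card_sum]
  exact Finset.sum_congr rfl fun j _ => card_locationsAt _ _

theorem oddPowerSum_locationsAt [Algebra (ZMod 4) R] (x : R) (a : ZMod 4) (i : ℕ) :
    oddPowerSum (locationsAt x a) i = algebraMap (ZMod 4) R a * x ^ (2 * i + 1) := by
  have h3 : algebraMap (ZMod 4) R 3 = -1 := by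
    rw [show (3 : ZMod 4) = -1 from rfl, map_neg, map_one]
  rcases zmod4_cases a with rfl | rfl | rfl | rfl
  · simp [locationsAt_zero, oddPowerSum]
  · simp [locationsAt_one, oddPowerSum]
  · rw [map_ofNat, two_mul]; simp [locationsAt_two, oddPowerSum]
  · rw [h3]; simp [locationsAt_three, oddPowerSum, Odd.neg_pow ⟨i, rfl⟩]

theorem oddPowerSum_errorLocations [Algebra (ZMod 4) R] {n : ℕ} (α : R) (e : Fin n → ZMod 4)
    (i : ℕ) : oddPowerSum (errorLocations α e) i =
      ∑ j, algebraMap (ZMod 4) R (e j) * (α ^ (2 * i + 1)) ^ (j : ℕ) := by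
  have hadd : oddPowerSum (errorLocations α e) i =
      ∑ j : Fin n, oddPowerSum (locationsAt (α ^ (j : ℕ)) (e j)) i := by
    let φ : Multiset R →+ R :=
      { toFun := fun L => oddPowerSum L i
        map_zero' := by simp [oddPowerSum]
        map_add' := fun L L' => by simp [oddPowerSum] }
    exact map_sum φ _ _
  rw [hadd]
  refine Finset.sum_congr rfl fun j _ => ?_
  rw [oddPowerSum_locationsAt, ← pow_mul, ← pow_mul, mul_comm (j : ℕ)]

theorem errorLocator_add (L L' : Multiset R) :
    errorLocator (L + L') = errorLocator L * errorLocator L' := by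
  simp [errorLocator]

theorem errorLocator_singleton (x : R) : errorLocator {x} = 1 - C x * X := by
  simp [errorLocator]

theorem errorLocator_singleton_neg (x : R) : errorLocator {-x} = 1 + C x * X := by
  rw [errorLocator_singleton, C_neg, neg_mul, sub_neg_eq_add]

theorem errorLocator_pair (x : R) : errorLocator {x, x} = (1 - C x * X) ^ 2 := by
  simp [errorLocator, sq]

/-- The other error locations contribute a unit to the value of the error locator polynomial at
the inverse of a location. -/
theorem isUnit_eval_errorLocator {L : Multiset R} {x y : R} (hxy : x * y = 1 ∨ x * y = -1)
    (hL : ∀ z ∈ L, IsUnit (x - z) ∧ IsUnit (x + z)) : IsUnit ((errorLocator L).eval y) := by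
  rw [eval_errorLocator]
  induction L using Multiset.induction with
  | empty => simp
  | cons z L ih =>
    rw [Multiset.map_cons, Multiset.prod_cons]
    refine IsUnit.mul ?_ (ih fun w hw => hL w (Multiset.mem_cons_of_mem hw))
    have hz := hL z (Multiset.mem_cons_self _ _)
    refine isUnit_of_mul_isUnit_right (x := x) ?_
    rcases hxy with h | h
    · rw [show x * (1 - z * y) = x - z by linear_combination -z * h]; exact hz.1
    · rw [show x * (1 - z * y) = x + z by linear_combination -z * h]; exact hz.2

theorem isUnit_of_mem_errorLocations {n : ℕ} {α : R} (hα : IsPrimitiveRoot α (2 * n))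
    {e : Fin n → ZMod 4} {x : R} (hx : x ∈ errorLocations α e) : IsUnit x := by
  obtain ⟨j, -, hj⟩ := Multiset.mem_sum.1 hx
  have hu : IsUnit (α ^ (j : ℕ)) := (hα.isUnit (by have := j.2; omega)).pow _
  rcases eq_or_eq_neg_of_mem_locationsAt hj with rfl | rfl
  exacts [hu, hu.neg]

section Root

variable [IsGR4 R] {n : ℕ} {α : R}

/-- The powers `1, α, …, αⁿ⁻¹` are distinct modulo `2`: if `αᵈ ≡ 1 mod 2` then `α²ᵈ = 1`. -/
theorem isUnit_pow_sub_pow (hα : IsPrimitiveRoot α (2 * n)) {i j : ℕ} (hi : i < n) (hj : j < n)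
    (hij : i ≠ j) : IsUnit (α ^ i - α ^ j) := by
  wlog hlt : i < j generalizing i j
  · have := this hj hi hij.symm (by omega)
    rw [← neg_sub]; exact this.neg
  have hu : IsUnit α := hα.isUnit (by omega)
  obtain ⟨d, rfl⟩ := Nat.exists_eq_add_of_lt hlt
  rw [show α ^ i - α ^ (i + d + 1) = α ^ i * (1 - α ^ (d + 1)) by ring]
  refine (hu.pow i).mul ?_
  rw [IsGR4.isUnit_iff]
  rintro ⟨w, hw⟩
  have h1 : α ^ (2 * (d + 1)) = 1 := by
    rw [mul_comm, pow_mul, show α ^ (d + 1) = 1 - 2 * w by linear_combination -hw]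
    linear_combination (w ^ 2 - w) * IsGR4.four_eq_zero (R := R)
  have := Nat.le_of_dvd (by omega) ((hα.pow_eq_one_iff_dvd _).1 h1)
  omega

theorem isUnit_pow_add_pow (hα : IsPrimitiveRoot α (2 * n)) {i j : ℕ} (hi : i < n) (hj : j < n)
    (hij : i ≠ j) : IsUnit (α ^ i + α ^ j) := by
  have h := isUnit_pow_sub_pow hα hi hj hij
  rw [IsGR4.isUnit_iff] at h ⊢
  intro h'
  refine h ?_
  rw [show α ^ i - α ^ j = (α ^ i + α ^ j) - 2 * α ^ j by ring]
  exact dvd_sub h' (dvd_mul_right _ _)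

/-- Separates the locations at one position from all others. -/
theorem exists_errorLocations_eq_add (hα : IsPrimitiveRoot α (2 * n)) (e : Fin n → ZMod 4)
    (j : Fin n) : ∃ L : Multiset R,
      errorLocations α e = locationsAt (α ^ (j : ℕ)) (e j) + L ∧
      ∀ z ∈ L, IsUnit (α ^ (j : ℕ) - z) ∧ IsUnit (α ^ (j : ℕ) + z) := by
  refine ⟨∑ i ∈ Finset.univ.erase j, locationsAt (α ^ (i : ℕ)) (e i),
    (Finset.add_sum_erase _ _ (Finset.mem_univ j)).symm, fun z hz => ?_⟩
  obtain ⟨i, hi, hzi⟩ := Multiset.mem_sum.1 hz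
  have hne : (j : ℕ) ≠ i := fun h => (Finset.mem_erase.1 hi).1 (Fin.ext h.symm)
  have h1 := isUnit_pow_sub_pow hα j.2 i.2 hne
  have h2 := isUnit_pow_add_pow hα j.2 i.2 hne
  rcases eq_or_eq_neg_of_mem_locationsAt hzi with rfl | rfl
  · exact ⟨h1, h2⟩
  · rw [sub_neg_eq_add, ← sub_eq_add_neg]
    exact ⟨h2, h1⟩

/-- Distinct error locations differ by units, and only a double error repeats a location. -/
theorem errorLocations_separated (hα : IsPrimitiveRoot α (2 * n)) {e : Fin n → ZMod 4}
    {x : R} (hx : x ∈ errorLocations α e) :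
    ∃ L₁ : Multiset R, (∀ y ∈ L₁, IsUnit (y - x)) ∧
      (errorLocations α e = x ::ₘ L₁ ∨
        (errorLocations α e = x ::ₘ x ::ₘ L₁ ∧ ∃ j, e j = 2)) := by
  obtain ⟨j, -, hj⟩ := Multiset.mem_sum.1 hx
  obtain ⟨L₁, hL, hsep⟩ := exists_errorLocations_eq_add hα e j
  rw [hL]
  rcases zmod4_cases (e j) with h | h | h | h <;> rw [h] at hj ⊢
  · simp [locationsAt_zero] at hj
  · rw [locationsAt_one, Multiset.mem_singleton] at hj
    subst hj
    exact ⟨L₁, fun y hy => by rw [← neg_sub]; exact (hsep y hy).1.neg, .inl rfl⟩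
  · have hj : x = α ^ (j : ℕ) := by simpa [locationsAt_two] using hj
    subst hj
    exact ⟨L₁, fun y hy => by rw [← neg_sub]; exact (hsep y hy).1.neg,
      .inr ⟨by simp [locationsAt_two], j, h⟩⟩
  · rw [locationsAt_three, Multiset.mem_singleton] at hj
    subst hj
    exact ⟨L₁, fun y hy => by rw [sub_neg_eq_add, add_comm]; exact (hsep y hy).2, .inl rfl⟩

theorem isKeySolution_keyPair {n t : ℕ} {α : R} (hα : IsPrimitiveRoot α (2 * n))
    {e : Fin n → ZMod 4} (he : ∑ j, leeWeight (e j) ≤ t) {T : R[X]}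
    (hT : ∀ i ≤ t, (1 + T).coeff i =
      PowerSeries.coeff i (keySeries (errorLocations α e))) :
    IsKeySolution t T (keyPair (errorLocations α e)) := by
  have hunit : ∀ x ∈ errorLocations α e, IsUnit x := fun x => isUnit_of_mem_errorLocations hα
  obtain ⟨hd, hu⟩ := natDegree_keyPair _ hunit
  refine isKeySolution_iff.2 ⟨keyPair_mem_solutionModule _ t T hT, ?_, ?_, hu⟩
  · rw [hd, card_errorLocations]; omega
  · refine two_mem_span_keyPair _ hunit fun x hx => ?_
    obtain ⟨L₁, h1, h2⟩ := errorLocations_separated hα hx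
    exact ⟨L₁, h1, h2.imp id And.left⟩

end Root

/-! ### Syndromes and the solution of the key equation -/

section Algebra

variable [Algebra (ZMod 4) R]

theorem syndromes_val {n t : ℕ} (α : R) (v : Fin n → ZMod 4) {i : ℕ} (hi : i < t) :
    (syndromes t α v).val i =
      ∑ j, algebraMap (ZMod 4) R (v j) * (α ^ (2 * i + 1)) ^ (j : ℕ) := by
  have hval : (syndromes t α v).val i = if h : i < t then
      (horner n (fun j => if h : j < n then algebraMap (ZMod 4) R (v ⟨j, h⟩) else 0)
        ((geometric α (α * α) t).val i)).val else 0 := rfl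
  rw [hval, dif_pos hi, horner_val, geometric_val _ _ _ _ hi, Finset.sum_range]
  refine Finset.sum_congr rfl fun j _ => ?_
  rw [dif_pos j.2]
  congr 2
  ring

/-- Code words have vanishing syndromes. -/
theorem sum_eq_zero_of_wordClass_mem {n t : ℕ} {α : R} {I : Ideal (NegacyclicRing n)}
    {g : (ZMod 4)[X]} (hα : α ^ n = -1) (hI : I = Ideal.span {Ideal.Quotient.mk _ g})
    (hg : ∀ i < t, aeval (α ^ (2 * i + 1)) g = 0) {c : Fin n → ZMod 4} (hc : wordClass c ∈ I)
    {i : ℕ} (hi : i < t) :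
    ∑ j, algebraMap (ZMod 4) R (c j) * (α ^ (2 * i + 1)) ^ (j : ℕ) = 0 := by
  rw [hI, Ideal.mem_span_singleton] at hc
  obtain ⟨q, hq⟩ := hc
  obtain ⟨q, rfl⟩ := Ideal.Quotient.mk_surjective q
  rw [wordClass, ← map_mul, Ideal.Quotient.mk_eq_mk_iff_sub_mem, Ideal.mem_span_singleton] at hq
  obtain ⟨w, hw⟩ := hq
  have hroot : (α ^ (2 * i + 1)) ^ n = -1 := by
    rw [← pow_mul, mul_comm, pow_mul, hα, Odd.neg_one_pow ⟨i, rfl⟩]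
  have h := congrArg (aeval (α ^ (2 * i + 1))) hw
  simp only [map_sub, map_mul, hg i hi, map_add, map_pow, aeval_X, hroot, map_one, zero_mul,
    neg_add_cancel, sub_zero, map_sum, aeval_monomial] at h
  exact h

variable [IsGR4 R]

/-- For a word at Lee distance at most `t` from a word with vanishing syndromes, the key equation
is solved both by the pair of the error locator polynomial and by the pair the decoder finds. -/
theorem exists_isKeySolution {n t : ℕ} {α : R} (hα : IsPrimitiveRoot α (2 * n))
    {solve : R[X] → Counted (R[X] × R[X])} (hsolve : IsKeySolver t solve)
    {v c : Fin n → ZMod 4} (he : ∑ j, leeWeight (v j - c j) ≤ t)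
    (hc : ∀ i < t, ∑ j, algebraMap (ZMod 4) R (c j) * (α ^ (2 * i + 1)) ^ (j : ℕ) = 0) :
    ∃ T : R[X], IsKeySolution t T (keyPair (errorLocations α fun j => v j - c j)) ∧
      IsKeySolution t T (solveFromSyndromes solve t (syndromes t α v).val).val := by
  set L := errorLocations α fun j => v j - c j with hL
  have hs : ∀ i < t, (syndromes t α v).val i = oddPowerSum L i := by
    intro i hi
    rw [syndromes_val α v hi, hL, oddPowerSum_errorLocations, ← sub_zero (∑ j, _), ← hc i hi,
      ← Finset.sum_sub_distrib]
    refine Finset.sum_congr rfl fun j _ => ?_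
    rw [map_sub]; ring
  have hT := tPoly_coeff L t _ (uCoeffs_val L t _ hs)
  have hsol := isKeySolution_keyPair hα he hT
  exact ⟨_, hsol, hsolve _ ⟨_, hsol⟩⟩

end Algebra

/-! ### Locator polynomials from solutions of the key equation -/

/-- The polynomial `h(z²) + z⁻¹ (g(z²) - h(z²))` of a pair `[g, h]`. -/
def pairLocator (p : R[X] × R[X]) : R[X] := interleave (p.2, divX (p.1 - p.2))

/-- The decoder's list of `2 (t + 2)` coefficients is long enough for every small pair. -/
theorem locator_val {t : ℕ} {p : R[X] × R[X]} (hp : (interleave p).natDegree ≤ t + 1) :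
    (locator (t + 2) p).val = pairLocator p := by
  have h1 : ∀ i, t + 2 ≤ i → p.1.coeff i = 0 := fun i hi =>
    coeff_eq_zero_of_natDegree_lt (by have := natDegree_fst_le p; omega)
  have h2 : ∀ i, t + 2 ≤ i → p.2.coeff i = 0 := fun i hi => by
    by_cases h0 : p.2 = 0
    · simp [h0]
    · exact coeff_eq_zero_of_natDegree_lt (by have := natDegree_snd_le h0; omega)
  refine ofCoeffs_val_eq (fun k _ => ?_) fun k hk => ?_
  · rcases Nat.even_or_odd' k with ⟨i, rfl | rfl⟩
    · rw [if_pos (even_two_mul i), pairLocator, coeff_interleave_even]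
      simp [pure_val]
    · rw [if_neg (by simp), pairLocator, coeff_interleave_odd, coeff_divX, coeff_sub,
        show (2 * i + 1) / 2 = i by omega]
      rfl
  · rcases Nat.even_or_odd' k with ⟨i, rfl | rfl⟩
    · rw [pairLocator, coeff_interleave_even]; exact h2 i (by omega)
    · rw [pairLocator, coeff_interleave_odd, coeff_divX, coeff_sub, h1 _ (by omega),
        h2 _ (by omega), sub_zero]

theorem coeff_pairLocator_eq_zero {t : ℕ} {p : R[X] × R[X]}
    (hp : (interleave p).natDegree ≤ t + 1) (i : ℕ) (hi : 2 * (t + 2) ≤ i) :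
    (pairLocator p).coeff i = 0 := by
  rw [← locator_val hp, locator, ofCoeffs_coeff, if_neg (by omega)]

theorem pairLocator_smul_keyPair (q : R[X]) (L : Multiset R) :
    pairLocator (q • keyPair L) = expand R 2 q * errorLocator L := by
  rw [← interleave_locatorParts, ← interleave_smul, pairLocator]
  congr 1
  refine Prod.ext rfl ?_
  simp only [keyPair, Prod.smul_fst, Prod.smul_snd, smul_eq_mul]
  rw [show q * ((locatorParts L).1 + X * (locatorParts L).2) - q * (locatorParts L).1 =
    X * (q * (locatorParts L).2) by ring]
  ext i
  rw [coeff_divX, coeff_X_mul]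

theorem map_pairLocator {S : Type} [CommRing S] (φ : R →+* S) (p : R[X] × R[X]) :
    (pairLocator p).map φ = pairLocator (p.1.map φ, p.2.map φ) := by
  rw [pairLocator, map_interleave, pairLocator]
  congr 2
  ext i
  simp [coeff_divX]

theorem pairLocator_C_smul (c : R) (p : R[X] × R[X]) :
    pairLocator (C c • p) = C c * pairLocator p := by
  have h : C c * pairLocator p = expand R 2 (C c) * pairLocator p := by rw [expand_C]
  rw [h, pairLocator, pairLocator, ← interleave_smul]
  congr 1
  refine Prod.ext rfl ?_
  ext i
  simp [coeff_divX, mul_sub]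

theorem pairLocator_keyPair (L : Multiset R) : pairLocator (keyPair L) = errorLocator L := by
  have := pairLocator_smul_keyPair 1 L
  simpa using this

/-- A solution that is proportional to the true one modulo `2` yields the error locator polynomial
modulo `2`, up to a constant factor. -/
theorem map_pairLocator_eq {p : R[X] × R[X]} {L : Multiset R} {θ : R}
    (h : (interleave p).map (red R) = C (red R θ) * (interleave (keyPair L)).map (red R)) :
    (pairLocator p).map (red R) = C (red R θ) * (errorLocator L).map (red R) := by
  rw [map_interleave, map_interleave, show (C (red R θ) : (Residue R)[X]) =
    expand _ 2 (C (red R θ)) by rw [expand_C], ← interleave_smul] at h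
  rw [map_pairLocator, interleave_injective h, pairLocator_C_smul, ← map_pairLocator,
    pairLocator_keyPair]

/-- A multiple of a unimodular pair that is a constant multiple modulo `2` is a unit multiple. -/
theorem pairLocator_eq_of_unimodular [IsGR4 R] {t : ℕ} {T : R[X]} {p : R[X] × R[X]}
    {L : Multiset R} (hk : IsKeySolution t T (keyPair L)) (hp : IsKeySolution t T p)
    (h1 : (1 : R[X]) ∈ Ideal.span {(keyPair L).1, (keyPair L).2}) (y : R) :
    ∃ u : R, IsUnit u ∧ (pairLocator p).eval y = u * (errorLocator L).eval y := by
  obtain ⟨hmem, hd, -, hu⟩ := isKeySolution_iff.1 hk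
  obtain ⟨hmem', hd', -, -⟩ := isKeySolution_iff.1 hp
  obtain ⟨A, B, hAB⟩ := Ideal.mem_span_pair.1 h1
  have hcross := fst_mul_snd_eq hmem hmem' hd hd'
  set q := A * p.1 + B * p.2 with hq
  have hpq : p = q • keyPair L := by
    refine Prod.ext ?_ ?_
    · simp only [Prod.smul_fst, smul_eq_mul]
      linear_combination -p.1 * hAB - B * hcross
    · simp only [Prod.smul_snd, smul_eq_mul]
      linear_combination -p.2 * hAB + A * hcross
  obtain ⟨θ, hθ, hθeq⟩ := hk.unique_mod_two hp
  rw [hpq, interleave_smul, Polynomial.map_mul] at hθeq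
  have hqθ := mul_right_cancel₀ (map_red_ne_zero_of_isUnit_leadingCoeff hu) hθeq
  refine ⟨(expand R 2 q).eval y, ?_, ?_⟩
  · rw [IsGR4.isUnit_iff_red_ne_zero, ← eval_map_apply, hqθ, eval_C]
    exact IsGR4.isUnit_iff_red_ne_zero.1 hθ
  · rw [← eval_mul, ← pairLocator_smul_keyPair, ← hpq]

end

section

/-! ### Correctness of the decoder -/

variable {R : Type} [CommRing R]

theorem isRoot_val {A : Type} [CommRing A] {N : ℕ} {f : A[X]} (hf : ∀ i, N ≤ i → f.coeff i = 0)
    (x : A) : (isRoot N f x).val = true ↔ f.eval x = 0 := by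
  change (isZero (horner N f.coeff x).val).val = true ↔ _
  rw [isZero_val, horner_coeff_val hf]

theorem isDoubleRoot_val {A : Type} [CommRing A] {N : ℕ} {f : A[X]}
    (hf : ∀ i, N ≤ i → f.coeff i = 0) (x : A) :
    (isDoubleRoot N f x).val = true ↔ f.eval x = 0 ∧ (derivative f).eval x = 0 := by
  have hd : ∀ i, N - 1 ≤ i → (derivative f).coeff i = 0 := fun i hi => by
    rw [coeff_derivative, hf _ (by omega), zero_mul]
  have hval : (ofCoeffs (N - 1) fun i => mul ((i + 1 : ℕ) : A) (f.coeff (i + 1))).val =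
      derivative f := by
    refine ofCoeffs_val_eq (fun i _ => ?_) hd
    rw [coeff_derivative, mul_comm]
    push_cast; rfl
  change ((isRoot N f x).val && (isRoot (N - 1) (ofCoeffs (N - 1) fun i =>
    mul ((i + 1 : ℕ) : A) (f.coeff (i + 1))).val x).val) = true ↔ _
  rw [hval, Bool.and_eq_true, isRoot_val hf, isRoot_val hd]

section Roots

variable [IsGR4 R] {n : ℕ} {α : R}

/-- Modulo `2`, the double roots of the error locator polynomial are the inverses of the locations
of the double errors. -/
theorem double_root_iff (hα : IsPrimitiveRoot α (2 * n)) (e : Fin n → ZMod 4) (j : Fin n) {y : R}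
    (hy : α ^ (j : ℕ) * y = 1) {θ : R} (hθ : IsUnit θ) {f : (Residue R)[X]}
    (hf : f = C (red R θ) * (errorLocator (errorLocations α e)).map (red R)) :
    (f.eval (red R y) = 0 ∧ (derivative f).eval (red R y) = 0) ↔ e j = 2 := by
  obtain ⟨L, hL, hsep⟩ := exists_errorLocations_eq_add hα e j
  have hθ0 := IsGR4.isUnit_iff_red_ne_zero.1 hθ
  have hL0 : (((errorLocator L).map (red R)).eval (red R y)) ≠ 0 := by
    rw [eval_map_apply]
    exact IsGR4.isUnit_iff_red_ne_zero.1 (isUnit_eval_errorLocator (.inl hy) hsep)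
  have hx0 : red R (α ^ (j : ℕ)) ≠ 0 :=
    IsGR4.isUnit_iff_red_ne_zero.1 ((hα.isUnit (by have := j.2; omega)).pow _)
  have hxy : red R (α ^ (j : ℕ)) * red R y = 1 := by rw [← map_mul, hy, map_one]
  rw [hL, errorLocator_add, Polynomial.map_mul] at hf
  set g := (errorLocator L).map (red R)
  set x := red R (α ^ (j : ℕ))
  have h2 : (2 : Residue R) = 0 := IsGR4.residue_two_eq_zero
  have hne0 : (0 : ZMod 4) ≠ 2 := by decide
  have hne1 : (1 : ZMod 4) ≠ 2 := by decide
  have hne3 : (3 : ZMod 4) ≠ 2 := by decide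
  rcases zmod4_cases (e j) with h | h | h | h <;> rw [h] at hf ⊢ <;>
    simp only [hne0, hne1, hne3, iff_false, iff_true, not_and]
  · intro h0
    rw [hf, locationsAt_zero, errorLocator_zero, Polynomial.map_one, one_mul, eval_mul,
      eval_C] at h0
    exact absurd h0 (mul_ne_zero hθ0 hL0)
  · intro _ h0
    rw [hf, locationsAt_one, errorLocator_singleton] at h0
    simp only [Polynomial.map_sub, Polynomial.map_one, Polynomial.map_mul, map_C, map_X,
      derivative_mul, derivative_C, derivative_sub, derivative_one, derivative_X, eval_add,
      eval_mul, eval_sub, eval_C, eval_X, eval_one, eval_zero] at h0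
    refine mul_ne_zero (mul_ne_zero hθ0 hx0) hL0 ?_
    linear_combination -h0 - red R θ * (derivative g).eval (red R y) * hxy
  · rw [hf, locationsAt_two, errorLocator_pair]
    simp only [Polynomial.map_sub, Polynomial.map_one, Polynomial.map_mul, map_C, map_X, sq,
      derivative_mul, derivative_C, derivative_sub, derivative_one, derivative_X, eval_add,
      eval_mul, eval_sub, eval_C, eval_X, eval_one, eval_zero]
    change red R θ * ((1 - x * red R y) * (1 - x * red R y) * _) = 0 ∧ _
    rw [hxy]
    constructor <;> ring
  · intro _ h0
    rw [hf, locationsAt_three, errorLocator_singleton_neg] at h0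
    simp only [Polynomial.map_add, Polynomial.map_one, Polynomial.map_mul, map_C, map_X,
      derivative_mul, derivative_C, derivative_add, derivative_one, derivative_X, eval_add,
      eval_mul, eval_C, eval_X, eval_one, eval_zero] at h0
    refine mul_ne_zero (mul_ne_zero hθ0 hx0) hL0 ?_
    linear_combination h0 - red R θ * (derivative g).eval (red R y) * hxy -
      red R θ * (derivative g).eval (red R y) * h2

/-- Without double errors, the roots of the error locator polynomial over `R` are the inverses of
the error locations. -/
theorem root_iff (hα : IsPrimitiveRoot α (2 * n)) {e : Fin n → ZMod 4} (he : ∀ j, e j ≠ 2)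
    (j : Fin n) {y : R} (hy : α ^ (j : ℕ) * y = 1) :
    ((errorLocator (errorLocations α e)).eval y = 0 ↔ e j = 1) ∧
    ((errorLocator (errorLocations α e)).eval (-y) = 0 ↔ e j = 3) := by
  obtain ⟨L, hL, hsep⟩ := exists_errorLocations_eq_add hα e j
  have h1 := isUnit_eval_errorLocator (.inl hy) hsep
  have h2 := isUnit_eval_errorLocator (y := -y) (.inr (by rw [mul_neg, hy])) hsep
  rw [hL, errorLocator_add, eval_mul, eval_mul, h1.mul_left_eq_zero, h2.mul_left_eq_zero]
  have hne2 : (2 : R) ≠ 0 := IsGR4.two_ne_zero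
  have h01 : (0 : ZMod 4) ≠ 1 := by decide
  have h03 : (0 : ZMod 4) ≠ 3 := by decide
  have h13 : (1 : ZMod 4) ≠ 3 := by decide
  rcases zmod4_cases (e j) with h | h | h | h <;> rw [h]
  · simp [locationsAt_zero, h01, h03]
  · simp only [locationsAt_one, errorLocator_singleton, eval_sub, eval_mul, eval_one, eval_C,
      eval_X, mul_neg, hy, sub_self, h13, iff_false, sub_neg_eq_add]
    exact ⟨trivial, by norm_num [hne2]⟩
  · exact absurd h (he j)
  · simp only [locationsAt_three, errorLocator_singleton_neg, eval_add, eval_mul, eval_one, eval_C,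
      eval_X, mul_neg, hy, add_neg_cancel, h13.symm, iff_false]
    exact ⟨by norm_num [hne2], by norm_num⟩

end Roots

variable [Algebra (ZMod 4) R] [IsGR4 R]

/-- The decoder is correct for every admissible way of solving the key equation.  The first pass
removes the double errors; the second pass is then applied to a word with errors `±1` only. -/
theorem decodeWith_val {n t : ℕ} {α : R} (hα : IsPrimitiveRoot α (2 * n)) (hα' : α ^ n = -1)
    {solve : R[X] → Counted (R[X] × R[X])} (hsolve : IsKeySolver t solve)
    {v c : Fin n → ZMod 4} (he : ∑ j, leeWeight (v j - c j) ≤ t)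
    (hc : ∀ i < t, ∑ j, algebraMap (ZMod 4) R (c j) * (α ^ (2 * i + 1)) ^ (j : ℕ) = 0) :
    (decodeWith solve t α v).val =
      { doubleErrors := fun j => if v j - c j = 2 then 2 else 0
        unitErrors := fun j => if v j - c j = 2 then 0 else v j - c j
        codeword := c } := by
  set pos := (geometric 1 α (n + 1)).val with hpos
  set neg := (geometric 1 (div 1 α).val n).val with hneg
  set p := (solveFromSyndromes solve t (syndromes t α v).val).val with hp
  set σ := (locator (t + 2) p).val with hσ
  set σbar := (ofCoeffs (2 * (t + 2)) fun k => reduce (σ.coeff k)).val with hσbar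
  set e2 : Fin n → ZMod 4 := fun j =>
    if (isDoubleRoot (2 * (t + 2)) σbar (reduce (neg j)).val).val then 2 else 0 with he2
  set v' : Fin n → ZMod 4 := fun j => v j - e2 j with hv'
  set p' := (solveFromSyndromes solve t (syndromes t α v').val).val with hp'
  set σ' := (locator (t + 2) p').val with hσ'
  set e1 : Fin n → ZMod 4 := fun j =>
    if (isRoot (2 * (t + 2)) σ' (neg j)).val then 1
      else if (isRoot (2 * (t + 2)) σ' (pos (n - j))).val then 3 else 0 with he1
  have hval : (decodeWith solve t α v).val = ⟨e2, e1, fun j => v' j - e1 j⟩ := rfl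
  rw [hval]
  -- the tables of powers of `α`
  have hneg_mul : ∀ j : Fin n, α ^ (j : ℕ) * neg j = 1 := by
    intro j
    have hαinv : 1 = α * (div 1 α).val :=
      div_val (hα.isUnit (by have := j.2; omega)).dvd
    rw [hneg, geometric_val _ _ _ _ j.2, one_mul, ← mul_pow, ← hαinv, one_pow]
  have hpos_eq : ∀ j : Fin n, pos (n - j) = -neg j := by
    intro j
    have hu := (hα.isUnit (by have := j.2; omega)).pow (j : ℕ)
    refine hu.mul_left_cancel ?_
    rw [hpos, geometric_val _ _ _ _ (by omega), one_mul, ← pow_add, mul_neg, hneg_mul,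
      show (j : ℕ) + (n - j) = n by omega, hα']
  -- first pass
  obtain ⟨T, hk, hs⟩ := exists_isKeySolution hα hsolve he hc
  obtain ⟨θ, hθ, hθeq⟩ := hk.unique_mod_two hs
  have hdeg := (isKeySolution_iff.1 hs).2.1
  have hσbar_eq : σbar = C (red R θ) *
      (errorLocator (errorLocations α fun j => v j - c j)).map (red R) := by
    rw [← map_pairLocator_eq hθeq, hσbar, hσ, locator_val hdeg]
    refine ofCoeffs_val_eq (fun i _ => ?_) fun i hi => ?_
    · rw [coeff_map]; rfl
    · rw [coeff_map, coeff_pairLocator_eq_zero hdeg i hi, map_zero]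
  have hσbar_coeff : ∀ i, 2 * (t + 2) ≤ i → σbar.coeff i = 0 := fun i hi => by
    rw [hσbar, ofCoeffs_coeff, if_neg (by omega)]
  have he2_eq : ∀ j, e2 j = if v j - c j = 2 then 2 else 0 := by
    intro j
    have hiff := (isDoubleRoot_val hσbar_coeff (red R (neg j))).trans
      (double_root_iff hα (fun j => v j - c j) j (hneg_mul j) hθ hσbar_eq)
    exact if_congr hiff rfl rfl
  -- second pass
  set e' : Fin n → ZMod 4 := fun j => v' j - c j with he'
  have he'_eq : ∀ j, e' j = if v j - c j = 2 then 0 else v j - c j := by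
    intro j
    simp only [he', hv', he2_eq]
    split_ifs with h
    · linear_combination h
    · ring
  have he'_ne : ∀ j, e' j ≠ 2 := by
    intro j
    rw [he'_eq]
    split_ifs with h
    · decide
    · exact h
  have he'_sum : ∑ j, leeWeight (v' j - c j) ≤ t := by
    refine le_trans (Finset.sum_le_sum fun j _ => ?_) he
    change leeWeight (e' j) ≤ _
    rw [he'_eq]
    split_ifs
    · exact Nat.zero_le _
    · exact le_rfl
  obtain ⟨T', hk', hs'⟩ := exists_isKeySolution hα hsolve he'_sum hc
  have hdeg' := (isKeySolution_iff.1 hs').2.1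
  have hone := one_mem_span_keyPair (errorLocations α e')
    (fun x => isUnit_of_mem_errorLocations hα) (fun x hx => by
      obtain ⟨L₁, h1, h2 | ⟨-, j, hj⟩⟩ := errorLocations_separated hα hx
      · exact ⟨L₁, h1, h2⟩
      · exact absurd hj (he'_ne j))
  have hroot : ∀ y, (isRoot (2 * (t + 2)) σ' y).val = true ↔
      (errorLocator (errorLocations α e')).eval y = 0 := by
    intro y
    obtain ⟨u, hu, hueq⟩ := pairLocator_eq_of_unimodular hk' hs' hone y
    rw [hσ', locator_val hdeg', isRoot_val (coeff_pairLocator_eq_zero hdeg'), hueq,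
      hu.mul_right_eq_zero]
  have he1_eq : ∀ j, e1 j = e' j := by
    intro j
    obtain ⟨h1, h3⟩ := root_iff hα he'_ne j (hneg_mul j)
    have h1' := (hroot (neg j)).trans h1
    have h3' := (hroot (-neg j)).trans h3
    rw [← hpos_eq] at h3'
    change (if _ then _ else if _ then _ else _) = _
    rw [if_congr h1' rfl (if_congr h3' rfl rfl)]
    rcases zmod4_cases (e' j) with h | h | h | h
    · rw [h]; decide
    · rw [h]; decide
    · exact absurd h (he'_ne j)
    · rw [h]; decide
  ext j
  · exact he2_eq j
  · exact (he1_eq j).trans (he'_eq j)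
  · change v' j - e1 j = c j
    rw [he1_eq]
    exact sub_sub_cancel _ _

end

section

/-! ### The number of operations -/

namespace Counted

variable {A B S : Type}

theorem bind_cost_le {x : Counted A} {f : A → Counted B} {a b : ℕ} (hx : x.cost ≤ a)
    (hf : ∀ v, (f v).cost ≤ b) : (x >>= f).cost ≤ a + b :=
  Nat.add_le_add hx (hf _)

theorem pure_cost_le (a : A) (b : ℕ) : (pure a : Counted A).cost ≤ b := Nat.zero_le _

theorem loop_cost_le {step : ℕ → S → Counted S} {N c : ℕ} (s : S)
    (h : ∀ i < N, ∀ s, (step i s).cost ≤ c) : (loop step s N).cost ≤ N * c := by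
  induction N with
  | zero => exact Nat.zero_le _
  | succ N ih =>
    rw [add_mul, one_mul]
    exact bind_cost_le (ih fun i hi => h i (by omega)) (h N (by omega))

theorem tabulate_cost_le {k c : ℕ} {f : Fin k → Counted A} (h : ∀ i, (f i).cost ≤ c) :
    (tabulate f).cost ≤ k * c := by
  exact (Finset.sum_le_card_nsmul Finset.univ (fun i => (f i).cost) c fun i _ => h i).trans
    (by simp)

variable [CommRing A]

theorem sum_cost_le {N c : ℕ} {f : ℕ → Counted A} (h : ∀ i < N, (f i).cost ≤ c) :
    (Counted.sum N f).cost ≤ N * (c + 1) :=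
  loop_cost_le _ fun i hi _ => bind_cost_le (h i hi) fun _ => le_rfl

theorem ofCoeffs_cost_le {N c : ℕ} {f : ℕ → Counted A} (h : ∀ i < N, (f i).cost ≤ c) :
    (ofCoeffs N f).cost ≤ N * c := by
  exact (Finset.sum_le_card_nsmul (Finset.range N) (fun i => (f i).cost) c fun i hi =>
    h i (Finset.mem_range.1 hi)).trans (by simp)

theorem horner_cost_le (N : ℕ) (f : ℕ → A) (x : A) : (horner N f x).cost ≤ N * 2 :=
  loop_cost_le _ fun _ _ _ => bind_cost_le (a := 1) (b := 1) le_rfl fun _ => le_rfl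

theorem geometric_cost_le (a b : A) (N : ℕ) : (geometric a b N).cost ≤ N :=
  (bind_cost_le (a := N * 1) (b := 0) (loop_cost_le _ fun _ _ _ =>
    bind_cost_le (a := 1) (b := 0) le_rfl fun _ => le_rfl) fun _ => le_rfl).trans (by omega)

end Counted

variable {R : Type} [CommRing R]

theorem findDegree_cost_le (N : ℕ) (f : R[X]) : (findDegree N f).cost ≤ N :=
  (loop_cost_le (c := 1) _ fun _ _ _ => bind_cost_le (a := 1) (b := 0) le_rfl fun _ => le_rfl).trans
    (by omega)

theorem findLeadTerm_cost_le (ℓ : ℤ) (N : ℕ) (p : R[X] × R[X]) :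
    (findLeadTerm ℓ N p).cost ≤ N + (N + 0) :=
  bind_cost_le (findDegree_cost_le _ _) fun _ => bind_cost_le (findDegree_cost_le _ _) fun _ =>
    le_rfl

theorem discrepancy_cost_le (U : R[X]) (k : ℕ) (p : R[X] × R[X]) :
    (discrepancy U k p).cost ≤ (k + 1) * (1 + 1) + 1 :=
  bind_cost_le (sum_cost_le fun _ _ => le_rfl) fun _ => le_rfl

theorem subMul_cost_le (N : ℕ) (f : R[X]) (x : R) (g : R[X]) : (subMul N f x g).cost ≤ N * 2 :=
  ofCoeffs_cost_le fun _ _ => bind_cost_le (a := 1) (b := 1) le_rfl fun _ => le_rfl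

theorem findPivot_cost_le (ℓ : ℤ) (τ : Fin 4 → PairTerm) (ζ : Fin 4 → R) (i : Fin 4) :
    (findPivot ℓ τ ζ i).cost ≤ 4 * 1 + 0 :=
  bind_cost_le (tabulate_cost_le fun _ => le_rfl) fun _ => le_rfl

theorem approxStep_cost_le (ℓ : ℤ) (U : R[X]) {N k : ℕ} (hk : k < N) (B : Fin 4 → R[X] × R[X]) :
    (approxStep ℓ U N k B).cost ≤ 32 * N + 28 := by
  refine (bind_cost_le (tabulate_cost_le fun i => discrepancy_cost_le U k (B i)) fun ζ =>
    bind_cost_le (tabulate_cost_le fun i => findLeadTerm_cost_le ℓ N (B i)) fun τ =>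
    tabulate_cost_le (c := 1 + (4 + (1 + (N * 2 + (N * 2 + 0))))) fun i =>
    bind_cost_le le_rfl fun b => ?_).trans (b := 4 * ((k + 1) * (1 + 1) + 1) +
      (4 * (N + (N + 0)) + 4 * (1 + (4 + (1 + (N * 2 + (N * 2 + 0))))))) (by omega)
  cases b
  · refine bind_cost_le (findPivot_cost_le ℓ τ ζ i) fun o => ?_
    rcases o with _ | j
    · exact pure_cost_le _ _
    · exact bind_cost_le le_rfl fun x => bind_cost_le (subMul_cost_le _ _ _ _) fun f =>
        bind_cost_le (subMul_cost_le _ _ _ _) fun g => le_rfl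
  · exact pure_cost_le _ _

theorem approxBasis_cost_le (ℓ : ℤ) (U : R[X]) (r : ℕ) :
    (approxBasis ℓ U r).cost ≤ 60 * (r + 1) ^ 2 := by
  refine (loop_cost_le (c := 32 * (r + 1) + 28) _ fun k hk B =>
    approxStep_cost_le ℓ U (by omega) B).trans ?_
  nlinarith

theorem isRegularPoly_cost_le (N : ℕ) (f : R[X]) : (isRegularPoly N f).cost ≤ N :=
  (loop_cost_le (c := 1) _ fun _ _ _ => bind_cost_le (a := 1) (b := 0) le_rfl fun _ => le_rfl).trans
    (by omega)

theorem minimalRegular_cost_le (ℓ : ℤ) (N : ℕ) (B : Fin 4 → R[X] × R[X]) :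
    (minimalRegular ℓ N B).cost ≤ 16 * N := by
  refine (bind_cost_le (tabulate_cost_le (c := N + (N + 0)) fun i =>
    bind_cost_le (isRegularPoly_cost_le _ _) fun b =>
    bind_cost_le (isRegularPoly_cost_le _ _) fun b' => le_rfl) fun ρ =>
    bind_cost_le (b := 0) (tabulate_cost_le fun i => findLeadTerm_cost_le ℓ N (B i)) fun τ =>
      ?_).trans (b := 4 * (N + (N + 0)) + (4 * (N + (N + 0)) + 0)) (by omega)
  split <;> exact le_rfl

theorem approxSolve_cost_le (t : ℕ) (T : R[X]) :
    (approxSolve t T).cost ≤ 300 * (t + 1) ^ 2 := by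
  refine (bind_cost_le (a := 1) le_rfl fun u => bind_cost_le (approxBasis_cost_le _ _ _) fun B =>
    minimalRegular_cost_le _ _ _).trans ?_
  nlinarith

theorem uCoeffs_cost_le (t : ℕ) (s : ℕ → R) : (uCoeffs t s).cost ≤ t * (4 * t) + 0 := by
  refine bind_cost_le (loop_cost_le _ fun i hi r => ?_) fun _ => le_rfl
  refine (bind_cost_le (sum_cost_le (c := 1) fun _ _ => le_rfl) fun y =>
    bind_cost_le (a := 1) le_rfl fun y' => bind_cost_le (a := 1) le_rfl fun x =>
    bind_cost_le (b := 0) (sum_cost_le (c := 1) fun _ _ => le_rfl) fun q => le_rfl).trans ?_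
  omega

theorem tPoly_cost_le (t : ℕ) (u : ℕ → R) : (tPoly t u).cost ≤ t * (2 * t) + 0 := by
  refine bind_cost_le (loop_cost_le _ fun i hi r => ?_) fun _ => le_rfl
  refine (bind_cost_le (sum_cost_le (c := 1) fun _ _ => le_rfl) fun y =>
    bind_cost_le (a := 1) le_rfl fun y' => bind_cost_le (a := 1) (b := 0) le_rfl fun x =>
    le_rfl).trans ?_
  omega

theorem solveFromSyndromes_cost_le (t : ℕ) (s : ℕ → R) :
    (solveFromSyndromes (approxSolve t) t s).cost ≤ 306 * (t + 1) ^ 2 := by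
  refine (bind_cost_le (uCoeffs_cost_le t s) fun u => bind_cost_le (tPoly_cost_le t u) fun T =>
    approxSolve_cost_le t T).trans ?_
  nlinarith

theorem locator_cost_le (N : ℕ) (p : R[X] × R[X]) : (locator N p).cost ≤ 2 * N * 1 := by
  refine ofCoeffs_cost_le fun i _ => ?_
  split_ifs
  · exact pure_cost_le _ _
  · exact le_rfl

theorem isRoot_cost_le {A : Type} [CommRing A] (N : ℕ) (f : A[X]) (x : A) :
    (isRoot N f x).cost ≤ N * 2 + 1 :=
  bind_cost_le (horner_cost_le _ _ _) fun _ => le_rfl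

theorem isDoubleRoot_cost_le {A : Type} [CommRing A] (N : ℕ) (f : A[X]) (x : A) :
    (isDoubleRoot N f x).cost ≤ 5 * N + 2 :=
  (bind_cost_le (ofCoeffs_cost_le (c := 1) fun _ _ => le_rfl) fun f' =>
    bind_cost_le (isRoot_cost_le _ _ _) fun b =>
    bind_cost_le (b := 0) (isRoot_cost_le _ _ _) fun b' => le_rfl).trans (by omega)

variable [Algebra (ZMod 4) R]

theorem syndromes_cost_le {n : ℕ} (t : ℕ) (α : R) (v : Fin n → ZMod 4) :
    (syndromes t α v).cost ≤ 1 + (t + (t * (n * 2) + 0)) :=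
  bind_cost_le le_rfl fun _ => bind_cost_le (geometric_cost_le _ _ _) fun _ =>
    bind_cost_le (tabulate_cost_le fun _ => horner_cost_le _ _ _) fun _ => le_rfl

theorem decode_cost_le {n : ℕ} (t : ℕ) (α : R) (v : Fin n → ZMod 4) :
    (decode t α v).cost ≤ 700 * ((t + 1) ^ 2 + n * (t + 1)) := by
  refine (bind_cost_le (a := 1) le_rfl fun αinv =>
    bind_cost_le (geometric_cost_le _ _ _) fun pos =>
    bind_cost_le (geometric_cost_le _ _ _) fun neg =>
    bind_cost_le (syndromes_cost_le t α v) fun s =>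
    bind_cost_le (solveFromSyndromes_cost_le t s) fun p =>
    bind_cost_le (locator_cost_le _ p) fun σ =>
    bind_cost_le (ofCoeffs_cost_le (c := 1) fun _ _ => le_rfl) fun σbar =>
    bind_cost_le (tabulate_cost_le (c := 1 + (5 * (2 * (t + 2)) + 2 + 0)) fun j =>
      bind_cost_le le_rfl fun x => bind_cost_le (isDoubleRoot_cost_le _ _ _) fun b =>
        le_rfl) fun e2 =>
    bind_cost_le (tabulate_cost_le (c := 1) fun _ => le_rfl) fun v' =>
    bind_cost_le (syndromes_cost_le t α v') fun s' =>
    bind_cost_le (solveFromSyndromes_cost_le t s') fun p' =>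
    bind_cost_le (locator_cost_le _ p') fun σ' =>
    bind_cost_le (tabulate_cost_le (c := 2 * (t + 2) * 2 + 1 + (2 * (t + 2) * 2 + 1 + 0)) fun j =>
      bind_cost_le (isRoot_cost_le _ _ _) fun b => bind_cost_le (isRoot_cost_le _ _ _) fun b' =>
        le_rfl) fun e1 =>
    bind_cost_le (b := 0) (tabulate_cost_le (c := 1) fun _ => le_rfl) fun c => le_rfl).trans ?_
  nlinarith [Nat.zero_le (n * t), Nat.zero_le (t * t)]

end

end

theorem mainTheorem2 :
    (∀ (m n t : ℕ) (R : Type) [CommRing R] [Algebra (ZMod 4) R] (α : R)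
        (C : Ideal (NegacyclicRing n)) (g : (ZMod 4)[X]),
      IsGaloisRing m R → Odd n → IsPrimitiveRoot α (2 * n) → α ^ n = -1 →
      C = Ideal.span {Ideal.Quotient.mk _ g} →
      (∀ i < t, aeval (α ^ (2 * i + 1)) g = 0) →
      -- the decoder recovers the codeword, the double errors and the errors `±1`
      (∀ v c : Fin n → ZMod 4, wordClass c ∈ C → leeDist v c ≤ t →
        (decode t α v).val =
          { doubleErrors := fun j => if v j - c j = 2 then 2 else 0
            unitErrors := fun j => if v j - c j = 2 then 0 else v j - c j
            codeword := c }) ∧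
      -- so does the decoder with any admissible solution of the key equations
      (∀ solve : R[X] → Counted (R[X] × R[X]), IsKeySolver t solve →
        ∀ v c : Fin n → ZMod 4, wordClass c ∈ C → leeDist v c ≤ t →
          (decodeWith solve t α v).val =
            { doubleErrors := fun j => if v j - c j = 2 then 2 else 0
              unitErrors := fun j => if v j - c j = 2 then 0 else v j - c j
              codeword := c }) ∧
      -- Solution by Approximations computes Gröbner bases and admissible solutions
      (∀ (U : R[X]) (r : ℕ),
        IsStandardGroebnerBasis (-1) (solutionModule U r) (approxBasis (-1) U r).val) ∧
      IsKeySolver t (approxSolve t : R[X] → Counted (R[X] × R[X]))) ∧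
    -- the number of operations
    (∃ κ : ℕ, ∀ (R : Type) [CommRing R] [Algebra (ZMod 4) R],
      (∀ (U : R[X]) (r : ℕ), (approxBasis (-1) U r).cost ≤ κ * (r + 1) ^ 2) ∧
      (∀ (t : ℕ) (s : ℕ → R),
        (solveFromSyndromes (approxSolve t) t s).cost ≤ κ * (t + 1) ^ 2) ∧
      (∀ (n t : ℕ) (α : R) (v : Fin n → ZMod 4),
        (decode t α v).cost ≤ κ * ((t + 1) ^ 2 + n * (t + 1)))) := by
  refine ⟨?_, 700, ?_⟩
  · intro m n t R _ _ α I g hR _ hα hα' hI hg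
    have := IsGR4.of_isGaloisRing hR
    have hdec : ∀ solve : R[X] → Counted (R[X] × R[X]), IsKeySolver t solve →
        ∀ v c : Fin n → ZMod 4, wordClass c ∈ I → leeDist v c ≤ t →
          (decodeWith solve t α v).val =
            { doubleErrors := fun j => if v j - c j = 2 then 2 else 0
              unitErrors := fun j => if v j - c j = 2 then 0 else v j - c j
              codeword := c } := fun solve hsolve v c hc he =>
      decodeWith_val hα hα' hsolve he fun i hi => sum_eq_zero_of_wordClass_mem hα' hI hg hc hi
    exact ⟨hdec _ (isKeySolver_approxSolve t), hdec,
      fun U r => (approxInvariant_approxBasis U r).isStandardGroebnerBasis,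
      isKeySolver_approxSolve t⟩
  · intro R _ _
    exact ⟨fun U r => (approxBasis_cost_le _ U r).trans (Nat.mul_le_mul_right _ (by norm_num)),
      fun t s => (solveFromSyndromes_cost_le t s).trans (Nat.mul_le_mul_right _ (by norm_num)),
      fun n t α v => decode_cost_le t α v⟩
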